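/- Let $\mu\in\mathbb R$, $\sigma>0$, $\zeta\ge 0$, and let $\Pi$ be a $\sigma$-finite Borel measure on $(-\infty,0)$ with $\int_{-\infty}^0 x^2\,\Pi(dx)<\infty$ and $\int_{-\infty}^{-1}|x|e^{-\zeta x}\,\Pi(dx)<\infty$. Put $$\psi(\lambda)=\mu\lambda+\frac{\sigma^2}{2}\lambda^2+\int_{-\infty}^0\left(e^{\lambda x}-1-\lambda x\right)\Pi(dx),$$ and let $(X_t)_{t\ge 0}$ be a Lévy process with $X_0=0$ and Laplace exponent $\psi$, i.e. $\mathbb E e^{\lambda X_t}=e^{t\psi(\lambda)}$ for all $t\geq 0$ and all complex $\lambda$ for which both sides are well defined. Write $$K(\lambda,z)=\frac{\psi'(\lambda)}{\psi(\lambda)-\psi(-\zeta-iz)}-\frac{1}{\lambda+\zeta+iz}.$$ For constants $c>0$ and $R_1>0$ consider the property (P) for every complex $\lambda$ with $\operatorname{Re}\lambda\ge R_1$: $\psi(\lambda)\ne\psi(-\zeta-iz)$ for all $z\in\mathbb R$, and $\int_{\mathbb R}|K(\lambda,z)|\,|f(z)|\,dz\le c\,|\lambda|\min\left(\|f\|_{L^1(\mathbb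 R)},\|f\|_{L^2(\mathbb R)}\right)$ for all $f\in L^1(\mathbb R)\cup L^2(\mathbb R)$ (an infinite norm being read as $+\infty$). Then there are constants $c,R_1>0$ with property (P). Moreover, let $c,R_1>0$ be any constants with property (P), and let $h:\mathbb R\to\mathbb R$ vanish on $[0,\infty)$ and satisfy $e^{\zeta x}h(x)=\int_{\mathbb R}e^{-ixz}\hat h(z)\,dz$ for all $x\in\mathbb R$, with some $\hat h\in L^1(\mathbb R)$. Then: 1. For every $\lambda$ with $\operatorname{Re}\lambda>R_1$ the integral $$F(\lambda)=\int_{\mathbb R}\left(\frac{\psi'(\lambda)}{\psi(\lambda)-\psi(-\zeta-iz)}-\frac{1}{\lambda+\zeta+iz}\right)\hat h(z)\,dz$$ converges absolutely, and $F$ is analytic in the half-plane $\{\operatorname{Re}\lambda>R_1\}$. 2. $F$ extends the function $\lambda\mapsto\psi'(\lambda)\Upsilon(\psi(\lambda))$: for all sufficiently large real $\lambda$, the expectation $\Upsilon(\psi(\lambda))$, where $\Upsilon(q)=\mathbb E\int_0^\infty e^{-qt}h(X_t)\,dt$, converges absolutely, and $$F(\lambda)=\psi'(\lambda)\Upsilon(\psi(\lambda))=\int_0^\infty\left(e^{\lambda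 x}-\psi'(\lambda)W^{\psi(\lambda)}(x)\right)h(-x)\,dx,$$ the last integral being absolutely convergent. Here, for real $q\geq 0$, the $q$-scale function $W^q:\mathbb R\to[0,\infty)$ is the right-continuous function vanishing on $(-\infty,0)$ with $\int_{\mathbb R}e^{-wx}W^q(x)\,dx=\frac{1}{\psi(w)-q}$ for all real $w>\Phi(q):=\sup\{s\ge 0:\psi(s)=q\}$. -/

import Mathlib

open MeasureTheory ProbabilityTheory Filter Set Topology
open scoped NNReal ENNReal

noncomputable section

/-- The conditions on the triplet `(μ, σ, ν)` and on `ζ`: `σ > 0`, `ζ ≥ 0`, and the jump measure `ν`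
is a σ-finite Borel measure carried by `(-∞, 0)` with `∫ x² dν < ∞` and
`∫_{(-∞, -1]} |x| e^{-ζ x} dν < ∞`. (The drift `μ` is an arbitrary real number.) -/
structure IsAdmissibleTriplet (σ ζ : ℝ) (ν : Measure ℝ) : Prop where
  sigma_pos : 0 < σ
  zeta_nonneg : 0 ≤ ζ
  sigmaFinite : SigmaFinite ν
  no_positive_jumps : ν (Ici 0) = 0
  second_moment : IntegrableOn (fun x : ℝ => x ^ 2) (Iio 0) ν
  exp_tail : IntegrableOn (fun x : ℝ => |x| * Real.exp (-ζ * x)) (Iic (-1)) ν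

/-- The Laplace exponent
`ψ(w) = μ w + (σ² / 2) w² + ∫_{(-∞, 0)} (e^{w x} - 1 - w x) ν(dx)` at a complex argument. -/
def laplaceExponent (μ σ : ℝ) (ν : Measure ℝ) (w : ℂ) : ℂ :=
  μ * w + (σ : ℂ) ^ 2 / 2 * w ^ 2 + ∫ x in Iio (0 : ℝ), (Complex.exp (w * x) - 1 - w * x) ∂ν

/-- The Laplace exponent at a real argument, as a real number. -/
def realLaplaceExponent (μ σ : ℝ) (ν : Measure ℝ) (s : ℝ) : ℝ :=
  μ * s + σ ^ 2 / 2 * s ^ 2 + ∫ x in Iio (0 : ℝ), (Real.exp (s * x) - 1 - s * x) ∂ν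

theorem laplaceExponent_ofReal (μ σ : ℝ) (ν : Measure ℝ) (s : ℝ) :
    laplaceExponent μ σ ν (s : ℂ) = (realLaplaceExponent μ σ ν s : ℂ) := by
  unfold laplaceExponent realLaplaceExponent
  push_cast [← integral_complex_ofReal]
  rfl

/-- A real-valued Lévy process started at `0`: independent and stationary increments, and almost
surely right-continuous paths with left limits. -/
structure IsLevyProcess {Ω : Type*} [MeasurableSpace Ω] (X : ℝ≥0 → Ω → ℝ) (P : Measure Ω) :
    Prop where
  measurable : ∀ t, Measurable (X t)
  start : ∀ᵐ ω ∂P, X 0 ω = 0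
  indep_increments : HasIndepIncrements X P
  stationary_increments : ∀ s t, IdentDistrib (fun ω => X (s + t) ω - X s ω) (X t) P P
  cadlag : ∀ᵐ ω ∂P, ∀ t,
    ContinuousWithinAt (fun s => X s ω) (Ici t) t ∧
      ∃ l, Tendsto (fun s => X s ω) (𝓝[<] t) (𝓝 l)

/-- `E e^{w X_t} = e^{t ψ(w)}` for all `t ≥ 0` and all complex `w` for which both sides are well
defined. (For purely imaginary `w` both sides are always well defined under the conditions on the
triplet.) -/
def HasLaplaceExponent {Ω : Type*} [MeasurableSpace Ω] (X : ℝ≥0 → Ω → ℝ) (P : Measure Ω)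
    (μ σ : ℝ) (ν : Measure ℝ) : Prop :=
  ∀ (t : ℝ≥0) (w : ℂ),
    Integrable (fun ω => Complex.exp (w * X t ω)) P →
    IntegrableOn (fun x : ℝ => Complex.exp (w * x) - 1 - w * x) (Iio 0) ν →
      ∫ ω, Complex.exp (w * X t ω) ∂P = Complex.exp (t * laplaceExponent μ σ ν w)

/-- The right inverse `Φ(q) = sup {s ≥ 0 : ψ(s) = q}` of the Laplace exponent. -/
def rightInverse (μ σ : ℝ) (ν : Measure ℝ) (q : ℝ) : ℝ :=
  sSup {s : ℝ | 0 ≤ s ∧ realLaplaceExponent μ σ ν s = q}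

/-- `W` is the `q`-scale function: nonnegative, right-continuous, zero on `(-∞, 0)`, with
`∫ e^{-w x} W(x) dx = 1 / (ψ(w) - q)` for all real `w > Φ(q)`. -/
structure IsScaleFunction (μ σ : ℝ) (ν : Measure ℝ) (q : ℝ) (W : ℝ → ℝ) : Prop where
  nonneg : ∀ x, 0 ≤ W x
  zero_of_neg : ∀ x < 0, W x = 0
  right_continuous : ∀ x, ContinuousWithinAt W (Ici x) x
  integrable : ∀ w, rightInverse μ σ ν q < w → Integrable (fun x : ℝ => Real.exp (-w * x) * W x)
  laplace : ∀ w, rightInverse μ σ ν q < w →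
    ∫ x : ℝ, Real.exp (-w * x) * W x = 1 / (realLaplaceExponent μ σ ν w - q)

/-- `h` vanishes on `[0, ∞)` and `x ↦ e^{ζ x} h(x)` is, at every real `x`, the Fourier transform
`∫ e^{-i x z} hhat(z) dz` of the integrable function `hhat`. -/
structure IsAdmissiblePayoff (ζ : ℝ) (h : ℝ → ℝ) (hhat : ℝ → ℂ) : Prop where
  support_subset : Function.support h ⊆ Iio 0
  integrable : Integrable hhat
  fourier : ∀ x : ℝ, ((Real.exp (ζ * x) * h x : ℝ) : ℂ) =
    ∫ z : ℝ, Complex.exp (-(Complex.I * x * z)) * hhat z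

/-- The time-Laplace transform `Υ(q) = E ∫_0^∞ e^{-q t} h(X_t) dt`. -/
def timeLaplace {Ω : Type*} [MeasurableSpace Ω] (X : ℝ≥0 → Ω → ℝ) (P : Measure Ω) (h : ℝ → ℝ)
    (q : ℝ) : ℝ :=
  ∫ ω, (∫ t in Ioi (0 : ℝ), Real.exp (-q * t) * h (X t.toNNReal ω)) ∂P

/-- The kernel `ψ'(w) / (ψ(w) - ψ(-ζ - i z)) - 1 / (w + ζ + i z)`. -/
def extensionKernel (μ σ ζ : ℝ) (ν : Measure ℝ) (w : ℂ) (z : ℝ) : ℂ :=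
  deriv (laplaceExponent μ σ ν) w /
      (laplaceExponent μ σ ν w - laplaceExponent μ σ ν (-ζ - Complex.I * z)) -
    1 / (w + ζ + Complex.I * z)

/-- The constants `c` and `R` of the a priori estimate: for all `w = v + i u` with `v ≥ R`,
`ψ(w) ≠ ψ(-ζ - i z)` for every real `z`, and for every `f` in `L¹ ∪ L²`,
`∫ |kernel(w, z)| |f(z)| dz ≤ c |w| min(‖f‖₁, ‖f‖₂)` (a norm being `∞` if it is not finite). -/
structure IsAprioriBound (μ σ ζ : ℝ) (ν : Measure ℝ) (c R : ℝ) : Prop where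
  c_pos : 0 < c
  R_pos : 0 < R
  ne : ∀ w : ℂ, R ≤ w.re → ∀ z : ℝ,
    laplaceExponent μ σ ν w ≠ laplaceExponent μ σ ν (-ζ - Complex.I * z)
  bound : ∀ w : ℂ, R ≤ w.re → ∀ f : ℝ → ℂ, (MemLp f 1 volume ∨ MemLp f 2 volume) →
    ∫⁻ z : ℝ, ‖extensionKernel μ σ ζ ν w z‖ₑ * ‖f z‖ₑ ≤
      ENNReal.ofReal (c * ‖w‖) * min (eLpNorm f 1 volume) (eLpNorm f 2 volume)

end

/-!
The jumps are negative, so the difference quotients of the Laplace exponent `ψ` between the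
half-plane `Re w ≥ -ζ` and a point `λ` far to the right have real part bounded below by `1`: the
Gaussian part contributes `σ² / 2 * Re (λ + w)`, the jumps at least a constant
(`IsAdmissibleTriplet.exists_le_re_slope`). Hence `|ψ(λ) - ψ(w)| ≥ |λ - w|`, and since
`ψ'` grows at most linearly, the extension kernel is bounded by a multiple of `|λ| / |λ + ζ + i z|`.
This function of `z` is bounded and square integrable, which gives the a priori bound. Conversely
the a priori bound controls the kernel pointwise, so that the integral of the kernel against `hhat`
may be differentiated under the integral sign.

For the probabilistic representation, the law of `X_t` must first be shown to have the exponential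
moment of order `-ζ`. Only its characteristic function is known, but `exp (t ψ)` is holomorphic in
the strip `-ζ < Re w < 0` and bounded on its closure by its values at real points. A contour shift
against a Gaussian weight (`integral_gaussian_mul_eq_of_strip`) bounds the Gaussian-damped moments
uniformly, and Fatou's lemma removes the damping. With `q = ψ(l)`, the potential measure
`U = E ∫ e^{-q t} 1_{X_t ∈ ·} dt` therefore has the transform `1 / (q - ψ(w))` on the line
`Re w = -ζ`. Fourier inversion of the payoff gives `∫ h dU = ∫ hhat(z) / (q - ψ(-ζ - i z)) dz`,
while the integral of `hhat(z) / (l + ζ + i z)` is the Laplace transform of `h` over `(0, ∞)`,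
that is `0`.

Finally, `U(dy) + W(-y) dy = e^{-l y} / ψ'(l) dy` for the scale function `W`
(`HasLaplaceExponent.potentialMeasure_add_reflectedMeasure`). The Laplace transforms of `U` and of
`W(-y) dy` converge in disjoint regions, to the left and to the right of the simple pole of
`1 / (ψ(w) - q)` at `w = l`, and the exponential on the right accounts for the residue there. After
subtraction of the pole the transform is bounded and holomorphic, so the Gaussian-weighted contour
can be moved across `l`; this shows that both sides have the same Gaussian transforms, and these
determine a measure. It follows that `U` has the density `e^{-l y} / ψ'(l) - W(-y)`, which turns
`ψ'(l) ∫ h dU` into the integral against the scale function.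
-/

/-! ### The Laplace exponent on the half-plane `Re w ≥ -ζ` -/

/-- The integrand of the jump part of the Laplace exponent. -/
noncomputable def jumpIntegrand (w : ℂ) (x : ℝ) : ℂ := Complex.exp (w * x) - 1 - w * x

/-- The derivative of `jumpIntegrand` in its first variable. -/
noncomputable def jumpIntegrandDeriv (w : ℂ) (x : ℝ) : ℂ := x * (Complex.exp (w * x) - 1)

/-- A function of the jump size that is integrable for an admissible triplet and that bounds, up to
the factor `1 + ‖w‖`, the derivative of the jump integrand on the whole half-plane
`Re w ≥ -ζ`. -/
noncomputable def jumpMajorant (ζ x : ℝ) : ℝ :=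
  Real.exp ζ * x ^ 2 + 2 * (Iic (-1 : ℝ)).indicator (fun x => |x| * Real.exp (-ζ * x)) x

theorem jumpMajorant_nonneg (ζ x : ℝ) : 0 ≤ jumpMajorant ζ x := by
  have : 0 ≤ (Iic (-1 : ℝ)).indicator (fun x => |x| * Real.exp (-ζ * x)) x :=
    indicator_nonneg (fun _ _ => by positivity) _
  unfold jumpMajorant
  positivity

theorem hasDerivAt_jumpIntegrand (w : ℂ) (x : ℝ) :
    HasDerivAt (fun w => jumpIntegrand w x) (jumpIntegrandDeriv w x) w := by
  have h1 : HasDerivAt (fun w : ℂ => w * x) (x : ℂ) w := by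
    simpa using (hasDerivAt_id w).mul_const (x : ℂ)
  have := (h1.cexp.sub_const 1).sub h1
  unfold jumpIntegrand jumpIntegrandDeriv
  convert! this using 1
  ring

theorem measurable_jumpIntegrand (w : ℂ) : Measurable (jumpIntegrand w) := by
  unfold jumpIntegrand
  fun_prop

theorem measurable_jumpIntegrandDeriv (w : ℂ) : Measurable (jumpIntegrandDeriv w) := by
  unfold jumpIntegrandDeriv
  fun_prop

theorem norm_exp_mul_le {ζ x : ℝ} (hx : x < 0) {w : ℂ} (hw : -ζ ≤ w.re) :
    ‖Complex.exp (w * x)‖ ≤ Real.exp (-ζ * x) := by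
  rw [Complex.norm_exp]
  simp only [Complex.mul_re, Complex.ofReal_re, Complex.ofReal_im, mul_zero, sub_zero]
  exact Real.exp_le_exp.2 (mul_le_mul_of_nonpos_right hw hx.le)

theorem norm_exp_mul_sub_exp_mul_le {ζ x : ℝ} (hx : x < 0) {w w' : ℂ} (hw : -ζ ≤ w.re)
    (hw' : -ζ ≤ w'.re) :
    ‖Complex.exp (w * x) - Complex.exp (w' * x)‖ ≤ |x| * Real.exp (-ζ * x) * ‖w - w'‖ := by
  refine Convex.norm_image_sub_le_of_norm_hasDerivWithin_le (s := {w : ℂ | -ζ ≤ w.re})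
    (f := fun w : ℂ => Complex.exp (w * x)) (f' := fun w => Complex.exp (w * x) * x) ?_ ?_
    (convex_halfSpace_re_ge _) hw' hw
  · intro w _
    have h1 : HasDerivAt (fun w : ℂ => w * x) (x : ℂ) w := by
      simpa using (hasDerivAt_id w).mul_const (x : ℂ)
    exact h1.cexp.hasDerivWithinAt
  · intro w hw
    rw [norm_mul, mul_comm, Complex.norm_real, Real.norm_eq_abs]
    exact mul_le_mul_of_nonneg_left (norm_exp_mul_le hx hw) (abs_nonneg _)

theorem norm_jumpIntegrandDeriv_le {ζ x : ℝ} (hζ : 0 ≤ ζ) (hx : x < 0) {w : ℂ}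
    (hw : -ζ ≤ w.re) :
    ‖jumpIntegrandDeriv w x‖ ≤ (1 + ‖w‖) * jumpMajorant ζ x := by
  unfold jumpIntegrandDeriv jumpMajorant
  rw [norm_mul, Complex.norm_real, Real.norm_eq_abs]
  by_cases hx1 : x ≤ -1
  · rw [indicator_of_mem (show x ∈ Iic (-1 : ℝ) from hx1)]
    have h1 : ‖Complex.exp (w * x) - 1‖ ≤ 2 * Real.exp (-ζ * x) := by
      refine (norm_sub_le _ _).trans ?_
      have := norm_exp_mul_le hx hw
      have h2 : 1 ≤ Real.exp (-ζ * x) := Real.one_le_exp (by nlinarith)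
      rw [norm_one]
      linarith
    have h3 : |x| * ‖Complex.exp (w * x) - 1‖ ≤ 2 * (|x| * Real.exp (-ζ * x)) := by
      have := mul_le_mul_of_nonneg_left h1 (abs_nonneg x)
      linarith
    have h4 : 0 ≤ Real.exp ζ * x ^ 2 := by positivity
    have h5 : 0 ≤ ‖w‖ := norm_nonneg w
    nlinarith [mul_nonneg h5 h4, mul_nonneg h5 ((mul_nonneg (abs_nonneg x)
      (norm_nonneg (Complex.exp (w * x) - 1))).trans h3)]
  · rw [indicator_of_notMem (by simpa using hx1)]
    push Not at hx1
    have h1 := norm_exp_mul_sub_exp_mul_le hx hw (w' := 0) (by simpa using hζ)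
    simp only [zero_mul, Complex.exp_zero, sub_zero] at h1
    have h2 : Real.exp (-ζ * x) ≤ Real.exp ζ := Real.exp_le_exp.2 (by nlinarith)
    calc |x| * ‖Complex.exp (w * x) - 1‖ ≤ |x| * (|x| * Real.exp ζ * ‖w‖) := by
          gcongr
          exact h1.trans (by gcongr)
      _ = ‖w‖ * (Real.exp ζ * x ^ 2) := by rw [← sq_abs x]; ring
      _ ≤ (1 + ‖w‖) * (Real.exp ζ * x ^ 2 + 2 * 0) := by
          have : 0 ≤ Real.exp ζ * x ^ 2 := by positivity
          linarith

theorem norm_jumpIntegrand_le {ζ x : ℝ} (hζ : 0 ≤ ζ) (hx : x < 0) {w : ℂ} (hw : -ζ ≤ w.re) :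
    ‖jumpIntegrand w x‖ ≤ (1 + ‖w‖) * ‖w‖ * jumpMajorant ζ x := by
  -- the jump integrand vanishes at `0`: mean value inequality on a convex set containing `0` and `w`
  have h := Convex.norm_image_sub_le_of_norm_hasDerivWithin_le
    (s := {w : ℂ | -ζ ≤ w.re} ∩ Metric.closedBall 0 ‖w‖)
    (f := fun w => jumpIntegrand w x) (f' := fun w => jumpIntegrandDeriv w x)
    (C := (1 + ‖w‖) * jumpMajorant ζ x) (x := 0) (y := w)
    (fun w _ => (hasDerivAt_jumpIntegrand w x).hasDerivWithinAt) ?_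
    ((convex_halfSpace_re_ge _).inter (convex_closedBall _ _)) ?_ ?_
  · simp only [sub_zero] at h
    have h0 : jumpIntegrand 0 x = 0 := by simp [jumpIntegrand]
    rw [h0, sub_zero] at h
    linarith
  · rintro v ⟨hv, hv'⟩
    refine (norm_jumpIntegrandDeriv_le hζ hx hv).trans ?_
    have := jumpMajorant_nonneg ζ x
    gcongr
    simpa using hv'
  · simpa using hζ
  · exact ⟨hw, by simp⟩

section Triplet

variable {μ σ ζ : ℝ} {ν : Measure ℝ}

theorem IsAdmissibleTriplet.integrableOn_jumpMajorant (hν : IsAdmissibleTriplet σ ζ ν) :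
    IntegrableOn (jumpMajorant ζ) (Iio 0) ν := by
  unfold jumpMajorant
  refine (hν.second_moment.const_mul _).add (Integrable.const_mul ?_ _)
  refine Integrable.integrableOn ?_
  rw [integrable_indicator_iff measurableSet_Iic]
  exact hν.exp_tail

theorem IsAdmissibleTriplet.integrableOn_jumpIntegrand (hν : IsAdmissibleTriplet σ ζ ν) {w : ℂ}
    (hw : -ζ ≤ w.re) : IntegrableOn (jumpIntegrand w) (Iio 0) ν := by
  refine (hν.integrableOn_jumpMajorant.const_mul ((1 + ‖w‖) * ‖w‖)).mono'
    (measurable_jumpIntegrand w).aestronglyMeasurable ?_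
  filter_upwards [ae_restrict_mem measurableSet_Iio] with x hx
  exact norm_jumpIntegrand_le hν.zeta_nonneg hx hw

theorem IsAdmissibleTriplet.hasDerivAt_laplaceExponent (hν : IsAdmissibleTriplet σ ζ ν) {w : ℂ}
    (hw : -ζ < w.re) :
    HasDerivAt (laplaceExponent μ σ ν)
      (μ + (σ : ℂ) ^ 2 * w + ∫ x in Iio (0 : ℝ), jumpIntegrandDeriv w x ∂ν) w := by
  have hJ : HasDerivAt (fun w => ∫ x in Iio (0 : ℝ), jumpIntegrand w x ∂ν)
      (∫ x in Iio (0 : ℝ), jumpIntegrandDeriv w x ∂ν) w := by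
    refine (hasDerivAt_integral_of_dominated_loc_of_deriv_le
      (s := {v : ℂ | -ζ < v.re} ∩ Metric.ball w 1)
      (bound := fun x => (1 + (‖w‖ + 1)) * jumpMajorant ζ x)
      (F := jumpIntegrand) (F' := jumpIntegrandDeriv) ?_ ?_ ?_ ?_ ?_ ?_ ?_).2
    · exact inter_mem ((isOpen_lt continuous_const Complex.continuous_re).mem_nhds hw)
        (Metric.ball_mem_nhds _ one_pos)
    · exact .of_forall fun v => (measurable_jumpIntegrand v).aestronglyMeasurable
    · exact hν.integrableOn_jumpIntegrand hw.le
    · exact (measurable_jumpIntegrandDeriv w).aestronglyMeasurable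
    · filter_upwards [ae_restrict_mem measurableSet_Iio] with x hx v hv
      refine (norm_jumpIntegrandDeriv_le hν.zeta_nonneg hx (show -ζ < v.re from hv.1).le).trans ?_
      have := jumpMajorant_nonneg ζ x
      have h2 : ‖v‖ ≤ ‖w‖ + 1 := by
        have h3 := hv.2
        rw [Metric.mem_ball, dist_eq_norm] at h3
        have := norm_sub_norm_le v w
        linarith
      gcongr
    · exact hν.integrableOn_jumpMajorant.const_mul _
    · exact .of_forall fun x v _ => hasDerivAt_jumpIntegrand v x
  have h1 : HasDerivAt (fun w : ℂ => μ * w + (σ : ℂ) ^ 2 / 2 * w ^ 2)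
      (μ + (σ : ℂ) ^ 2 * w) w := by
    have := ((hasDerivAt_id w).const_mul (μ : ℂ)).add
      (((hasDerivAt_id w).pow 2).const_mul ((σ : ℂ) ^ 2 / 2))
    convert! this using 1
    simp
    ring
  exact h1.add hJ

theorem IsAdmissibleTriplet.continuousOn_laplaceExponent (hν : IsAdmissibleTriplet σ ζ ν) :
    ContinuousOn (laplaceExponent μ σ ν) {w : ℂ | -ζ ≤ w.re} := by
  have hJ : ContinuousOn (fun w => ∫ x in Iio (0 : ℝ), jumpIntegrand w x ∂ν)
      {w : ℂ | -ζ ≤ w.re} := by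
    intro w hw
    have hc : ContinuousOn (fun w => ∫ x in Iio (0 : ℝ), jumpIntegrand w x ∂ν)
        ({v : ℂ | -ζ ≤ v.re} ∩ Metric.ball w 1) := by
      refine continuousOn_of_dominated
        (bound := fun x => (1 + (‖w‖ + 1)) * (‖w‖ + 1) * jumpMajorant ζ x) ?_ ?_ ?_ ?_
      · exact fun v _ => (measurable_jumpIntegrand v).aestronglyMeasurable
      · intro v hv
        filter_upwards [ae_restrict_mem measurableSet_Iio] with x hx
        refine (norm_jumpIntegrand_le hν.zeta_nonneg hx hv.1).trans ?_
        have := jumpMajorant_nonneg ζ x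
        have h2 : ‖v‖ ≤ ‖w‖ + 1 := by
          have h3 := hv.2
          rw [Metric.mem_ball, dist_eq_norm] at h3
          have := norm_sub_norm_le v w
          linarith
        gcongr
      · exact hν.integrableOn_jumpMajorant.const_mul _
      · exact .of_forall fun x v _ => (hasDerivAt_jumpIntegrand v x).continuousAt.continuousWithinAt
    exact (hc w ⟨hw, Metric.mem_ball_self one_pos⟩).mono_of_mem_nhdsWithin
      (inter_mem_nhdsWithin _ (Metric.ball_mem_nhds _ one_pos))
  have h1 : Continuous (fun w : ℂ => μ * w + (σ : ℂ) ^ 2 / 2 * w ^ 2) := by fun_prop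
  exact h1.continuousOn.add hJ

theorem IsAdmissibleTriplet.differentiableAt_laplaceExponent (hν : IsAdmissibleTriplet σ ζ ν)
    {w : ℂ} (hw : -ζ < w.re) : DifferentiableAt ℂ (laplaceExponent μ σ ν) w :=
  (hν.hasDerivAt_laplaceExponent hw).differentiableAt

theorem IsAdmissibleTriplet.differentiableOn_laplaceExponent (hν : IsAdmissibleTriplet σ ζ ν) :
    DifferentiableOn ℂ (laplaceExponent μ σ ν) {w : ℂ | -ζ < w.re} := fun _ hw =>
  (hν.differentiableAt_laplaceExponent hw).differentiableWithinAt

theorem isOpen_re_gt (a : ℝ) : IsOpen {w : ℂ | a < w.re} :=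
  isOpen_lt continuous_const Complex.continuous_re

theorem IsAdmissibleTriplet.differentiableAt_deriv_laplaceExponent
    (hν : IsAdmissibleTriplet σ ζ ν) {w : ℂ} (hw : -ζ < w.re) :
    DifferentiableAt ℂ (deriv (laplaceExponent μ σ ν)) w :=
  (hν.differentiableOn_laplaceExponent.deriv (isOpen_re_gt _)).differentiableAt
    ((isOpen_re_gt _).mem_nhds hw)

theorem IsAdmissibleTriplet.exists_norm_deriv_laplaceExponent_le (hν : IsAdmissibleTriplet σ ζ ν)
    (μ : ℝ) :
    ∃ C, 0 ≤ C ∧ ∀ w : ℂ, -ζ < w.re → ‖deriv (laplaceExponent μ σ ν) w‖ ≤ C * (1 + ‖w‖) := by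
  set I : ℝ := ∫ x in Iio (0 : ℝ), jumpMajorant ζ x ∂ν
  have hI : 0 ≤ I := integral_nonneg fun x => jumpMajorant_nonneg ζ x
  refine ⟨|μ| + σ ^ 2 + I, by positivity, fun w hw => ?_⟩
  rw [(hν.hasDerivAt_laplaceExponent hw).deriv]
  have h1 : ‖∫ x in Iio (0 : ℝ), jumpIntegrandDeriv w x ∂ν‖ ≤ (1 + ‖w‖) * I := by
    rw [← integral_const_mul]
    refine norm_integral_le_of_norm_le (hν.integrableOn_jumpMajorant.const_mul _) ?_
    filter_upwards [ae_restrict_mem measurableSet_Iio] with x hx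
    exact norm_jumpIntegrandDeriv_le hν.zeta_nonneg hx hw.le
  have h2 : ‖(μ : ℂ) + (σ : ℂ) ^ 2 * w‖ ≤ |μ| + σ ^ 2 * ‖w‖ := by
    refine (norm_add_le _ _).trans (le_of_eq ?_)
    simp
  refine (norm_add_le _ _).trans ((add_le_add h2 h1).trans ?_)
  nlinarith [norm_nonneg w, abs_nonneg μ, sq_nonneg σ, mul_nonneg (abs_nonneg μ) (norm_nonneg w)]

theorem realLaplaceExponent_eq_re (s : ℝ) :
    realLaplaceExponent μ σ ν s = (laplaceExponent μ σ ν s).re := by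
  rw [laplaceExponent_ofReal, Complex.ofReal_re]

theorem IsAdmissibleTriplet.deriv_laplaceExponent_ofReal (hν : IsAdmissibleTriplet σ ζ ν) {s : ℝ}
    (hs : -ζ < s) :
    deriv (laplaceExponent μ σ ν) (s : ℂ) = (deriv (realLaplaceExponent μ σ ν) s : ℝ) := by
  have h := (hν.differentiableAt_laplaceExponent (μ := μ) (w := (s : ℂ))
    (by simpa using hs)).hasDerivAt
  have h1 : HasDerivAt (realLaplaceExponent μ σ ν)
      (deriv (laplaceExponent μ σ ν) (s : ℂ)).re s := by
    have := h.real_of_complex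
    simpa only [← realLaplaceExponent_eq_re] using! this
  have h2 := h1.ofReal_comp.unique (h.comp_ofReal.congr_of_eventuallyEq
    (.of_forall fun t => (laplaceExponent_ofReal μ σ ν t).symm))
  rw [h1.deriv, h2]

/-- On a vertical line, the real part of the Laplace exponent is largest at the real point. -/
theorem IsAdmissibleTriplet.re_laplaceExponent_le (hν : IsAdmissibleTriplet σ ζ ν) {w : ℂ}
    (hw : -ζ ≤ w.re) : (laplaceExponent μ σ ν w).re ≤ realLaplaceExponent μ σ ν w.re := by
  rw [realLaplaceExponent_eq_re]
  have e (v : ℂ) (hv : -ζ ≤ v.re) : (laplaceExponent μ σ ν v).re =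
      μ * v.re + σ ^ 2 / 2 * (v.re ^ 2 - v.im ^ 2) +
        ∫ x in Iio (0 : ℝ), (jumpIntegrand v x).re ∂ν := by
    have h : ∫ x in Iio (0 : ℝ), (jumpIntegrand v x).re ∂ν =
      (∫ x in Iio (0 : ℝ), jumpIntegrand v x ∂ν).re :=
      integral_re (hν.integrableOn_jumpIntegrand hv)
    rw [h]
    have h2 : (σ : ℂ) ^ 2 / 2 = ((σ ^ 2 / 2 : ℝ) : ℂ) := by push_cast; rfl
    simp only [laplaceExponent, jumpIntegrand, Complex.add_re, h2, Complex.re_ofReal_mul]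
    rw [sq v, Complex.mul_re]
    ring
  have hw' : -ζ ≤ ((w.re : ℝ) : ℂ).re := by simpa using hw
  rw [e w hw, e _ hw']
  simp only [Complex.ofReal_re, Complex.ofReal_im]
  have h1 : ∫ x in Iio (0 : ℝ), (jumpIntegrand w x).re ∂ν ≤
      ∫ x in Iio (0 : ℝ), (jumpIntegrand w.re x).re ∂ν := by
    refine integral_mono (hν.integrableOn_jumpIntegrand hw).re
      (hν.integrableOn_jumpIntegrand hw').re fun x => ?_
    have h3 : (Complex.exp (w * x)).re ≤ Real.exp (w.re * x) := by
      refine (Complex.re_le_norm _).trans (le_of_eq ?_)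
      simp [Complex.norm_exp]
    have h4 : (Complex.exp ((w.re : ℂ) * x)).re = Real.exp (w.re * x) := by
      rw [← Complex.ofReal_mul, Complex.exp_ofReal_re]
    simp [jumpIntegrand, h4]
    simpa using h3
  nlinarith [mul_nonneg (sq_nonneg σ) (sq_nonneg w.im)]

theorem IsAdmissibleTriplet.continuousOn_realLaplaceExponent (hν : IsAdmissibleTriplet σ ζ ν) :
    ContinuousOn (realLaplaceExponent μ σ ν) (Ici (-ζ)) := by
  have h : ContinuousOn (fun s : ℝ => (laplaceExponent μ σ ν (s : ℂ)).re) (Ici (-ζ)) :=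
    Complex.continuous_re.comp_continuousOn (hν.continuousOn_laplaceExponent.comp
      Complex.continuous_ofReal.continuousOn fun s hs => by simpa using hs)
  exact h.congr fun s _ => realLaplaceExponent_eq_re s

/-- The difference quotients of the Laplace exponent with one end in the half-plane `Re w ≥ -ζ` and
the other far to the right have real part bounded below by a positive constant. The jumps
contribute at least the constant `-∫ |x| (e^{-ζ x} - 1) dν`, since
`|e^{w x} - e^{w' x}| ≤ |x| e^{-ζ x} |w - w'|`, whereas the Gaussian part contributes
`σ² / 2 * Re (w + w')`. -/
theorem IsAdmissibleTriplet.exists_le_re_slope (hν : IsAdmissibleTriplet σ ζ ν) (μ : ℝ) :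
    ∃ R, 1 ≤ R ∧ ∀ w w' : ℂ, R ≤ w.re → -ζ ≤ w'.re → w ≠ w' →
      1 ≤ ((laplaceExponent μ σ ν w - laplaceExponent μ σ ν w') / (w - w')).re := by
  set T : ℝ → ℝ := fun x => |x| * Real.exp (-ζ * x) - |x| with hT
  have hTint : IntegrableOn T (Iio 0) ν := by
    refine (hν.integrableOn_jumpMajorant.const_mul (1 + ζ)).mono'
      (by fun_prop) ?_
    filter_upwards [ae_restrict_mem measurableSet_Iio] with x hx
    have h := norm_jumpIntegrandDeriv_le hν.zeta_nonneg hx (w := ((-ζ : ℝ) : ℂ)) (by simp)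
    -- up to sign, `T` is the derivative of the jump integrand at `w = -ζ`
    have h2 : ‖jumpIntegrandDeriv ((-ζ : ℝ) : ℂ) x‖ = ‖T x‖ := by
      unfold jumpIntegrandDeriv
      rw [← Complex.ofReal_mul, ← Complex.ofReal_exp, ← Complex.ofReal_one, ← Complex.ofReal_sub,
        ← Complex.ofReal_mul, Complex.norm_real, hT]
      simp only [Real.norm_eq_abs]
      rw [← mul_sub_one, abs_mul, abs_mul, abs_abs]
    rw [h2] at h
    refine h.trans (le_of_eq ?_)
    rw [Complex.norm_real, Real.norm_eq_abs, abs_neg, abs_of_nonneg hν.zeta_nonneg]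
  set I : ℝ := ∫ x in Iio (0 : ℝ), T x ∂ν
  have hσ := hν.sigma_pos
  have hz := hν.zeta_nonneg
  -- this abscissa makes `μ + σ² / 2 * (Re w - ζ) - I` at least `1`
  refine ⟨max 1 (ζ + (1 + |μ| + I) / (σ ^ 2 / 2)), le_max_left _ _, fun w w' hw hw' hne => ?_⟩
  have hw1 : ζ + (1 + |μ| + I) / (σ ^ 2 / 2) ≤ w.re := (le_max_right _ _).trans hw
  have hw0 : 1 ≤ w.re := (le_max_left _ _).trans hw
  have hwz : -ζ ≤ w.re := by linarith
  have hd : w - w' ≠ 0 := sub_ne_zero.2 hne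
  have e : (laplaceExponent μ σ ν w - laplaceExponent μ σ ν w') / (w - w') =
      ((μ : ℝ) : ℂ) + ((σ ^ 2 / 2 : ℝ) : ℂ) * (w + w') +
        ∫ x in Iio (0 : ℝ), (jumpIntegrand w x - jumpIntegrand w' x) / (w - w') ∂ν := by
    rw [integral_div, integral_sub (hν.integrableOn_jumpIntegrand hwz)
      (hν.integrableOn_jumpIntegrand hw')]
    unfold laplaceExponent
    simp only [jumpIntegrand]
    push_cast
    field_simp
    ring
  have hint : IntegrableOn (fun x => (jumpIntegrand w x - jumpIntegrand w' x) / (w - w'))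
      (Iio 0) ν :=
    ((hν.integrableOn_jumpIntegrand hwz).sub (hν.integrableOn_jumpIntegrand hw')).div_const _
  have hre : -I ≤ (∫ x in Iio (0 : ℝ),
      (jumpIntegrand w x - jumpIntegrand w' x) / (w - w') ∂ν).re := by
    have h : ∫ x in Iio (0 : ℝ), ((jumpIntegrand w x - jumpIntegrand w' x) / (w - w')).re ∂ν = _ :=
      integral_re hint
    rw [← integral_neg]
    refine le_trans ?_ (le_of_eq h)
    refine integral_mono_ae hTint.neg hint.re ?_
    filter_upwards [ae_restrict_mem measurableSet_Iio] with x hx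
    have h1 := norm_exp_mul_sub_exp_mul_le hx hwz hw'
    have e2 : (jumpIntegrand w x - jumpIntegrand w' x) / (w - w') =
        (Complex.exp (w * x) - Complex.exp (w' * x)) / (w - w') - (x : ℂ) := by
      unfold jumpIntegrand
      field_simp
      ring
    have h2 : ‖(Complex.exp (w * x) - Complex.exp (w' * x)) / (w - w')‖ ≤
        |x| * Real.exp (-ζ * x) := by
      rw [norm_div, div_le_iff₀ (norm_pos_iff.2 hd)]
      exact h1
    have h3 := (abs_le.1 ((Complex.abs_re_le_norm _).trans h2)).1
    simp only [hT]
    rw [e2, Complex.sub_re, Complex.ofReal_re]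
    have h4 : |x| = -x := abs_of_neg hx
    linarith
  rw [e, Complex.add_re, Complex.add_re, Complex.ofReal_re, Complex.re_ofReal_mul, Complex.add_re]
  have hs : 0 < σ ^ 2 / 2 := by positivity
  have h5 : (1 + |μ| + I) / (σ ^ 2 / 2) ≤ w.re + w'.re := by linarith
  rw [div_le_iff₀ hs] at h5
  have := neg_abs_le μ
  linarith

end Triplet

/-! ### The a priori bound and the analyticity of the extension -/

section Kernel

variable {μ σ ζ : ℝ} {ν : Measure ℝ}

theorem re_neg_sub_I_mul (ζ z : ℝ) : (-ζ - Complex.I * z : ℂ).re = -ζ := by simp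

/-- The Laplace exponent expands distances between the half-planes `Re w ≥ R` and `Re w ≥ -ζ`. -/
theorem IsAdmissibleTriplet.exists_norm_sub_le (hν : IsAdmissibleTriplet σ ζ ν) (μ : ℝ) :
    ∃ R, 1 ≤ R ∧ ∀ w w' : ℂ, R ≤ w.re → -ζ ≤ w'.re →
      ‖w - w'‖ ≤ ‖laplaceExponent μ σ ν w - laplaceExponent μ σ ν w'‖ := by
  obtain ⟨R, hR, h⟩ := hν.exists_le_re_slope μ
  refine ⟨R, hR, fun w w' hw hw' => ?_⟩
  rcases eq_or_ne w w' with rfl | hne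
  · simp
  have h1 := (h w w' hw hw' hne).trans (Complex.re_le_norm _)
  rwa [norm_div, le_div_iff₀ (norm_pos_iff.2 (sub_ne_zero.2 hne)), one_mul] at h1

theorem sq_norm_add_add_I_mul (w : ℂ) (ζ z : ℝ) :
    ‖w + ζ + Complex.I * z‖ ^ 2 = (w.re + ζ) ^ 2 + (w.im + z) ^ 2 := by
  rw [Complex.sq_norm, Complex.normSq_apply]
  simp
  ring

/-- The extension kernel is dominated by a multiple of `|w| / |w + ζ + i z|`. -/
theorem IsAdmissibleTriplet.exists_norm_extensionKernel_le (hν : IsAdmissibleTriplet σ ζ ν)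
    (μ : ℝ) :
    ∃ C R, 0 < C ∧ 1 ≤ R ∧ ∀ w : ℂ, R ≤ w.re → ∀ z : ℝ,
      laplaceExponent μ σ ν w ≠ laplaceExponent μ σ ν (-ζ - Complex.I * z) ∧
      ‖extensionKernel μ σ ζ ν w z‖ ≤ C * ‖w‖ * (1 + (w.im + z) ^ 2) ^ (-(1 / 2) : ℝ) := by
  obtain ⟨R, hR, h⟩ := hν.exists_norm_sub_le μ
  obtain ⟨C, hC, hC'⟩ := hν.exists_norm_deriv_laplaceExponent_le μ
  have hζ := hν.zeta_nonneg
  refine ⟨2 * C + 1, R, by positivity, hR, fun w hw z => ?_⟩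
  have hw1 : 1 ≤ w.re := hR.trans hw
  have h1 := h w (-ζ - Complex.I * z) hw (by simp)
  have e1 : w - (-ζ - Complex.I * z) = w + ζ + Complex.I * z := by ring
  rw [e1] at h1
  have hsq : 1 + (w.im + z) ^ 2 ≤ ‖w + ζ + Complex.I * z‖ ^ 2 := by
    rw [sq_norm_add_add_I_mul]
    nlinarith
  have hpos : 0 < ‖w + ζ + Complex.I * z‖ := by
    by_contra hcon
    have : ‖w + ζ + Complex.I * z‖ = 0 := le_antisymm (not_lt.1 hcon) (norm_nonneg _)
    rw [this] at hsq
    nlinarith [sq_nonneg (w.im + z)]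
  refine ⟨fun heq => ?_, ?_⟩
  · rw [heq, sub_self, norm_zero] at h1
    linarith
  have hnw : 1 ≤ ‖w‖ := hw1.trans (Complex.re_le_norm w)
  have h2 : ‖extensionKernel μ σ ζ ν w z‖ ≤
      C * (1 + ‖w‖) / ‖w + ζ + Complex.I * z‖ + 1 / ‖w + ζ + Complex.I * z‖ := by
    unfold extensionKernel
    refine (norm_sub_le _ _).trans ?_
    rw [norm_div, norm_div, norm_one]
    have := hC' w (by linarith)
    gcongr
  have h3 : (1 + (w.im + z) ^ 2) ^ (1 / 2 : ℝ) ≤ ‖w + ζ + Complex.I * z‖ := by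
    rw [← Real.sqrt_eq_rpow]
    exact Real.sqrt_le_iff.2 ⟨hpos.le, hsq⟩
  have hp : 0 < (1 + (w.im + z) ^ 2) ^ (1 / 2 : ℝ) := by positivity
  rw [Real.rpow_neg (by positivity), ← div_eq_mul_inv]
  calc _ ≤ _ := h2
    _ = (C * (1 + ‖w‖) + 1) / ‖w + ζ + Complex.I * z‖ := by ring
    _ ≤ (C * (1 + ‖w‖) + 1) / (1 + (w.im + z) ^ 2) ^ (1 / 2 : ℝ) := by gcongr
    _ ≤ _ := by
      gcongr
      nlinarith

theorem lintegral_inv_one_add_sq_add (u : ℝ) :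
    ∫⁻ z : ℝ, ENNReal.ofReal ((1 + (u + z) ^ 2)⁻¹) = ENNReal.ofReal Real.pi := by
  rw [lintegral_add_left_eq_self (fun z : ℝ => ENNReal.ofReal ((1 + z ^ 2)⁻¹)) u,
    ← ofReal_integral_eq_lintegral_ofReal integrable_inv_one_add_sq
      (.of_forall fun z => by positivity), integral_univ_inv_one_add_sq]

/-- The `L¹` and the `L²` estimate follow from Hölder's inequality with the `L^∞` norm `1` and the
`L²` norm `√π ≤ 2` of `z ↦ (1 + (Im w + z)²) ^ (-1/2)`. -/
theorem IsAdmissibleTriplet.exists_isAprioriBound (hν : IsAdmissibleTriplet σ ζ ν) (μ : ℝ) :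
    ∃ c R, IsAprioriBound μ σ ζ ν c R := by
  obtain ⟨C, R, hC, hR, h⟩ := hν.exists_norm_extensionKernel_le μ
  refine ⟨2 * C, R, by positivity, by linarith, fun w hw z => (h w hw z).1, fun w hw f hf => ?_⟩
  have hfm : AEStronglyMeasurable f volume := hf.elim (fun h => h.1) (fun h => h.1)
  set g : ℝ → ℝ≥0∞ := fun z => ENNReal.ofReal ((1 + (w.im + z) ^ 2) ^ (-(1 / 2) : ℝ))
  have hK (z : ℝ) : ‖extensionKernel μ σ ζ ν w z‖ₑ ≤ ENNReal.ofReal (C * ‖w‖) * g z := by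
    rw [← ofReal_norm, ← ENNReal.ofReal_mul (by positivity)]
    exact ENNReal.ofReal_le_ofReal (h w hw z).2
  have hmain : ∫⁻ z : ℝ, ‖extensionKernel μ σ ζ ν w z‖ₑ * ‖f z‖ₑ ≤
      ENNReal.ofReal (C * ‖w‖) * ∫⁻ z, (g * fun z => ‖f z‖ₑ) z := by
    rw [← lintegral_const_mul' _ _ ENNReal.ofReal_ne_top]
    refine lintegral_mono fun z => ?_
    rw [Pi.mul_apply, ← mul_assoc]
    gcongr
    exact hK z
  have h2 : ENNReal.ofReal (2 * C * ‖w‖) = ENNReal.ofReal (C * ‖w‖) * 2 := by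
    rw [mul_assoc, ENNReal.ofReal_mul zero_le_two, mul_comm]
    simp
  rw [h2, mul_assoc]
  refine hmain.trans ?_
  gcongr
  rcases min_choice (eLpNorm f 1 volume) (eLpNorm f 2 volume) with hmin | hmin <;> rw [hmin]
  · rw [eLpNorm_one_eq_lintegral_enorm]
    calc ∫⁻ z, (g * fun z => ‖f z‖ₑ) z ≤ ∫⁻ z, ‖f z‖ₑ := by
          refine lintegral_mono fun z => ?_
          rw [Pi.mul_apply]
          refine mul_le_of_le_one_left' ?_
          rw [← ENNReal.ofReal_one]
          exact ENNReal.ofReal_le_ofReal (Real.rpow_le_one_of_one_le_of_nonpos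
            (by nlinarith [sq_nonneg (w.im + z)]) (by norm_num))
      _ ≤ 2 * ∫⁻ z, ‖f z‖ₑ := le_mul_of_one_le_left' one_le_two
  · refine (ENNReal.lintegral_mul_le_Lp_mul_Lq volume Real.HolderConjugate.two_two
      (by fun_prop) hfm.enorm).trans ?_
    rw [eLpNorm_eq_lintegral_rpow_enorm_toReal two_ne_zero ENNReal.ofNat_ne_top]
    simp only [ENNReal.toReal_ofNat]
    gcongr
    have e : ∀ z, g z ^ (2 : ℝ) = ENNReal.ofReal ((1 + (w.im + z) ^ 2)⁻¹) := by
      intro z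
      rw [ENNReal.ofReal_rpow_of_nonneg (by positivity) (by norm_num),
        ← Real.rpow_mul (by positivity)]
      norm_num
      rw [Real.rpow_neg_one]
    simp_rw [e]
    rw [lintegral_inv_one_add_sq_add, ENNReal.ofReal_rpow_of_nonneg Real.pi_pos.le (by norm_num)]
    rw [← Real.sqrt_eq_rpow, ← ENNReal.ofReal_ofNat 2]
    refine ENNReal.ofReal_le_ofReal (Real.sqrt_le_iff.2 ⟨by norm_num, ?_⟩)
    linarith [Real.pi_le_four]

theorem IsAdmissibleTriplet.continuous_laplaceExponent_line (hν : IsAdmissibleTriplet σ ζ ν) :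
    Continuous fun z : ℝ => laplaceExponent μ σ ν (-ζ - Complex.I * z) :=
  hν.continuousOn_laplaceExponent.comp_continuous (by fun_prop) fun z => by simp

section Bound

variable {c R : ℝ}

theorem add_add_I_mul_ne_zero {w : ℂ} {ζ : ℝ} (hζ : 0 ≤ ζ) (hw : 0 < w.re) (z : ℝ) :
    w + ζ + Complex.I * z ≠ 0 := fun h => by
  have := congrArg Complex.re h
  simp at this
  linarith

theorem IsAprioriBound.continuous_extensionKernel (hB : IsAprioriBound μ σ ζ ν c R)
    (hν : IsAdmissibleTriplet σ ζ ν) {w : ℂ} (hw : R ≤ w.re) :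
    Continuous (extensionKernel μ σ ζ ν w) := by
  unfold extensionKernel
  refine Continuous.sub (Continuous.div continuous_const
    (continuous_const.sub hν.continuous_laplaceExponent_line) fun z => ?_)
    (Continuous.div continuous_const (by fun_prop) fun z => ?_)
  · exact sub_ne_zero.2 (hB.ne w hw z)
  · exact add_add_I_mul_ne_zero hν.zeta_nonneg (hB.R_pos.trans_le hw) z

/-- The `L¹` part of the a priori bound, tested on indicators, is a pointwise bound of the
kernel. -/
theorem IsAprioriBound.norm_extensionKernel_le (hB : IsAprioriBound μ σ ζ ν c R)
    (hν : IsAdmissibleTriplet σ ζ ν) {w : ℂ} (hw : R ≤ w.re) (z : ℝ) :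
    ‖extensionKernel μ σ ζ ν w z‖ ≤ c * ‖w‖ := by
  have hc := hB.c_pos
  have hcont := hB.continuous_extensionKernel hν hw
  have hae : (fun z => ‖extensionKernel μ σ ζ ν w z‖ₑ) ≤ᵐ[volume]
      fun _ => ENNReal.ofReal (c * ‖w‖) := by
    refine ae_le_of_forall_setLIntegral_le_of_sigmaFinite hcont.measurable.enorm
      fun s hs hs' => ?_
    have hmem : MemLp (s.indicator fun _ => (1 : ℂ)) 1 volume :=
      memLp_indicator_const 1 hs 1 (Or.inr hs'.ne)
    have h := (hB.bound w hw _ (Or.inl hmem)).trans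
      (mul_le_mul_right (min_le_left _ _) _)
    rw [eLpNorm_one_eq_lintegral_enorm] at h
    have e (z : ℝ) : ‖s.indicator (fun _ => (1 : ℂ)) z‖ₑ = s.indicator 1 z := by
      by_cases hz : z ∈ s <;> simp [hz]
    simp_rw [e] at h
    rw [lintegral_indicator_one hs] at h
    rw [setLIntegral_const, ← lintegral_indicator hs]
    refine le_trans (le_of_eq (lintegral_congr fun z => ?_)) h
    by_cases hz : z ∈ s <;> simp [hz]
  -- the exceptional set is open and null, hence empty
  have hopen : IsOpen {z | c * ‖w‖ < ‖extensionKernel μ σ ζ ν w z‖} :=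
    isOpen_lt continuous_const hcont.norm
  have hnull : volume {z | c * ‖w‖ < ‖extensionKernel μ σ ζ ν w z‖} = 0 := by
    refine measure_mono_null (fun z hz => ?_) (ae_iff.1 hae)
    have hz' : c * ‖w‖ < ‖extensionKernel μ σ ζ ν w z‖ := hz
    show ¬ (_ ≤ _)
    simp only [not_le, ← ofReal_norm]
    exact (ENNReal.ofReal_lt_ofReal_iff_of_nonneg (by positivity)).2 hz'
  have hempty := hopen.measure_eq_zero_iff volume |>.1 hnull
  by_contra hcon
  exact eq_empty_iff_forall_notMem.1 hempty z (not_le.1 hcon)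

theorem IsAprioriBound.integrable_extensionKernel_mul (hB : IsAprioriBound μ σ ζ ν c R)
    (hν : IsAdmissibleTriplet σ ζ ν) {hhat : ℝ → ℂ} (hh : Integrable hhat) {w : ℂ}
    (hw : R ≤ w.re) : Integrable fun z : ℝ => extensionKernel μ σ ζ ν w z * hhat z :=
  hh.bdd_mul (hB.continuous_extensionKernel hν hw).aestronglyMeasurable
    (.of_forall fun z => hB.norm_extensionKernel_le hν hw z)

theorem IsAprioriBound.hasDerivAt_extensionKernel (hB : IsAprioriBound μ σ ζ ν c R)
    (hν : IsAdmissibleTriplet σ ζ ν) {w : ℂ} (hw : R ≤ w.re) (z : ℝ) :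
    HasDerivAt (fun w => extensionKernel μ σ ζ ν w z)
      ((deriv (deriv (laplaceExponent μ σ ν)) w *
          (laplaceExponent μ σ ν w - laplaceExponent μ σ ν (-ζ - Complex.I * z)) -
        deriv (laplaceExponent μ σ ν) w * deriv (laplaceExponent μ σ ν) w) /
          (laplaceExponent μ σ ν w - laplaceExponent μ σ ν (-ζ - Complex.I * z)) ^ 2 +
        1 / (w + ζ + Complex.I * z) ^ 2) w := by
  have hw0 : -ζ < w.re := by linarith [hB.R_pos, hν.zeta_nonneg]
  have hne := add_add_I_mul_ne_zero hν.zeta_nonneg (hB.R_pos.trans_le hw) z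
  have h1 := (hν.differentiableAt_deriv_laplaceExponent (μ := μ) hw0).hasDerivAt.div
    ((hν.differentiableAt_laplaceExponent (μ := μ) hw0).hasDerivAt.sub_const
      (laplaceExponent μ σ ν (-ζ - Complex.I * z))) (sub_ne_zero.2 (hB.ne w hw z))
  have h2 := (((hasDerivAt_id w).add_const (ζ : ℂ)).add_const (Complex.I * z)).inv hne
  have h3 := h1.sub h2
  unfold extensionKernel
  simp only [one_div]
  convert! h3 using 1
  simp only [id_eq]
  field_simp
  ring

/-- The kernel is holomorphic in `w` and locally bounded, uniformly in `z`; by Cauchy's estimate so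
is its derivative, and one may differentiate under the integral sign. -/
theorem IsAprioriBound.analyticOnNhd_integral_extensionKernel
    (hB : IsAprioriBound μ σ ζ ν c R) (hν : IsAdmissibleTriplet σ ζ ν) {hhat : ℝ → ℂ}
    (hh : Integrable hhat) :
    AnalyticOnNhd ℂ (fun w : ℂ => ∫ z : ℝ, extensionKernel μ σ ζ ν w z * hhat z)
      {w : ℂ | R < w.re} := by
  refine DifferentiableOn.analyticOnNhd (fun w₀ hw₀ => ?_) (isOpen_re_gt R)
  have hc := hB.c_pos
  have hw₀' : R < w₀.re := hw₀
  -- circles of radius `r` around points of the disc of radius `r` stay in the half-plane `Re w ≥ R`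
  set r : ℝ := (w₀.re - R) / 2 with hr
  have hr0 : 0 < r := by rw [hr]; linarith
  have hre {w : ℂ} (hw : ‖w - w₀‖ ≤ 2 * r) : R ≤ w.re := by
    have := (abs_le.1 ((Complex.abs_re_le_norm _).trans hw)).1
    rw [Complex.sub_re] at this
    linarith
  refine DifferentiableAt.differentiableWithinAt ?_
  refine (hasDerivAt_integral_of_dominated_loc_of_deriv_le (s := Metric.ball w₀ r)
    (F := fun w z => extensionKernel μ σ ζ ν w z * hhat z)
    (F' := fun w z => deriv (fun w => extensionKernel μ σ ζ ν w z) w * hhat z)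
    (bound := fun z => c * (‖w₀‖ + 2 * r) / r * ‖hhat z‖)
    (Metric.ball_mem_nhds _ hr0) ?_ ?_ ?_ ?_ ?_ ?_).2.differentiableAt
  · filter_upwards [Metric.ball_mem_nhds w₀ hr0] with w hw
    rw [Metric.mem_ball, dist_eq_norm] at hw
    exact (hB.integrable_extensionKernel_mul hν hh (hre (by linarith))).aestronglyMeasurable
  · exact hB.integrable_extensionKernel_mul hν hh hw₀'.le
  · refine AEStronglyMeasurable.mul (Continuous.aestronglyMeasurable ?_) hh.aestronglyMeasurable
    simp_rw [fun z => (hB.hasDerivAt_extensionKernel hν hw₀'.le z).deriv]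
    have hl := hν.continuous_laplaceExponent_line (μ := μ)
    refine Continuous.add (Continuous.div (by fun_prop) (by fun_prop) fun z => ?_)
      (Continuous.div continuous_const (by fun_prop) fun z => ?_)
    · exact pow_ne_zero _ (sub_ne_zero.2 (hB.ne w₀ hw₀'.le z))
    · exact pow_ne_zero _ (add_add_I_mul_ne_zero hν.zeta_nonneg (hB.R_pos.trans hw₀') z)
  · refine .of_forall fun z w hw => ?_
    rw [Metric.mem_ball, dist_eq_norm] at hw
    rw [norm_mul]
    gcongr
    have hcl {v : ℂ} (hv : ‖v - w‖ ≤ r) : ‖v - w₀‖ ≤ 2 * r := by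
      have := norm_add_le (v - w) (w - w₀)
      rw [sub_add_sub_cancel] at this
      linarith
    refine Complex.norm_deriv_le_of_forall_mem_sphere_norm_le hr0 ?_ fun v hv => ?_
    · refine DifferentiableOn.diffContOnCl_ball (U := Metric.closedBall w r)
        (fun v hv => ?_) subset_rfl
      rw [Metric.mem_closedBall, dist_eq_norm] at hv
      exact (hB.hasDerivAt_extensionKernel hν
        (hre (hcl hv)) z).differentiableAt.differentiableWithinAt
    · rw [mem_sphere_iff_norm] at hv
      refine (hB.norm_extensionKernel_le hν (hre (hcl hv.le)) z).trans ?_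
      gcongr
      have := norm_sub_norm_le v w₀
      linarith [hcl hv.le]
  · exact hh.norm.const_mul _
  · refine .of_forall fun z w hw => ?_
    rw [Metric.mem_ball, dist_eq_norm] at hw
    exact ((hB.hasDerivAt_extensionKernel hν
      (hre (by linarith)) z).differentiableAt.hasDerivAt).mul_const _

end Bound

end Kernel

/-! ### Gaussian-weighted integrals along vertical lines -/

theorem norm_exp_half_mul_sq (k x : ℝ) (w : ℂ) :
    ‖Complex.exp (k / 2 * (w - x) ^ 2)‖ = Real.exp (k / 2 * ((w.re - x) ^ 2 - w.im ^ 2)) := by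
  rw [Complex.norm_exp]
  have : (k / 2 * (w - x) ^ 2 : ℂ) = ((k / 2 : ℝ) : ℂ) * (w - x) ^ 2 := by push_cast; rfl
  rw [this, Complex.re_ofReal_mul, sq, Complex.mul_re]
  simp only [Complex.sub_re, Complex.ofReal_re, Complex.sub_im, Complex.ofReal_im, sub_zero]
  ring_nf

theorem integrable_exp_neg_half_mul_sq {k : ℝ} (hk : 0 < k) :
    Integrable fun u : ℝ => Real.exp (-(k / 2) * u ^ 2) :=
  integrable_exp_neg_mul_sq (half_pos hk)

/-- **Contour shift**: a function that is bounded and continuous on a closed vertical strip and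
holomorphic inside has the same integral against a Gaussian weight on both edges of the strip. -/
theorem integral_gaussian_mul_eq_of_strip {f : ℂ → ℂ} {a b k M : ℝ} (x : ℝ) (hab : a ≤ b)
    (hk : 0 < k) (hc : ContinuousOn f {w : ℂ | a ≤ w.re ∧ w.re ≤ b})
    (hd : DifferentiableOn ℂ f {w : ℂ | a < w.re ∧ w.re < b})
    (hM : ∀ w : ℂ, a ≤ w.re → w.re ≤ b → ‖f w‖ ≤ M) :
    ∫ u : ℝ, Complex.exp (k / 2 * (a + u * Complex.I - x) ^ 2) * f (a + u * Complex.I) =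
      ∫ u : ℝ, Complex.exp (k / 2 * (b + u * Complex.I - x) ^ 2) * f (b + u * Complex.I) := by
  set g : ℂ → ℂ := fun w => Complex.exp (k / 2 * (w - x) ^ 2) * f w with hg
  have hgc : ContinuousOn g {w : ℂ | a ≤ w.re ∧ w.re ≤ b} :=
    ContinuousOn.mul (by fun_prop) hc
  have hgd : DifferentiableOn ℂ g {w : ℂ | a < w.re ∧ w.re < b} :=
    DifferentiableOn.mul (by fun_prop) hd
  set D : ℝ := Real.exp (k / 2 * (|a| + |b| + |x|) ^ 2) * M with hD
  have hM0 : 0 ≤ M := (norm_nonneg _).trans (hM a (by simp) (by simpa using hab))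
  -- the weighted function decays like a Gaussian in `Im w`, uniformly over the strip
  have hbound (w : ℂ) (h1 : a ≤ w.re) (h2 : w.re ≤ b) :
      ‖g w‖ ≤ D * Real.exp (-(k / 2) * w.im ^ 2) := by
    rw [hg, norm_mul, norm_exp_half_mul_sq, mul_sub, sub_eq_add_neg, Real.exp_add, hD]
    have h3 : |w.re - x| ≤ |a| + |b| + |x| := by
      rw [abs_le]
      constructor <;>
      linarith [neg_abs_le a, le_abs_self b, neg_abs_le x, le_abs_self x, abs_nonneg a,
        abs_nonneg b]
    have h4 : (w.re - x) ^ 2 ≤ (|a| + |b| + |x|) ^ 2 := sq_le_sq' (by linarith [(abs_le.1 h3).1])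
      (le_of_abs_le h3)
    have h5 := hM w h1 h2
    calc _ ≤ Real.exp (k / 2 * (|a| + |b| + |x|) ^ 2) * Real.exp (-(k / 2 * w.im ^ 2)) * M := by
          gcongr
      _ = _ := by rw [← neg_mul]; ring
  have hline (s : ℝ) (h1 : a ≤ s) (h2 : s ≤ b) :
      Integrable fun u : ℝ => g (s + u * Complex.I) := by
    refine ((integrable_exp_neg_half_mul_sq hk).const_mul D).mono' ?_ (.of_forall fun u => ?_)
    · refine Continuous.aestronglyMeasurable (hgc.comp_continuous (by fun_prop) fun u => ?_)
      simpa using ⟨h1, h2⟩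
    · simpa using hbound (s + u * Complex.I) (by simpa using h1) (by simpa using h2)
  have hlim (s : ℝ) (h1 : a ≤ s) (h2 : s ≤ b) :
      Tendsto (fun T : ℝ => ∫ u in (-T)..T, g (s + u * Complex.I)) atTop
        (𝓝 (∫ u : ℝ, g (s + u * Complex.I))) :=
    intervalIntegral_tendsto_integral (hline s h1 h2) tendsto_neg_atTop_atBot tendsto_id
  have hdecay : Tendsto (fun T : ℝ => D * Real.exp (-(k / 2) * T ^ 2) * |b - a|) atTop (𝓝 0) := by
    have h1 : Tendsto (fun T : ℝ => -(k / 2) * T ^ 2) atTop atBot :=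
      (tendsto_pow_atTop two_ne_zero).const_mul_atTop_of_neg (by linarith)
    simpa using ((Real.tendsto_exp_atBot.comp h1).const_mul D).mul_const |b - a|
  have hside (e : ℝ → ℝ) (he : ∀ T, e T ^ 2 = T ^ 2) :
      Tendsto (fun T : ℝ => ∫ s in a..b, g (s + (e T : ℝ) * Complex.I)) atTop (𝓝 0) := by
    refine squeeze_zero_norm (fun T => ?_) hdecay
    refine intervalIntegral.norm_integral_le_of_norm_le_const fun s hs => ?_
    rw [uIoc_of_le hab] at hs
    have := hbound (s + (e T : ℝ) * Complex.I) (by simpa using hs.1.le) (by simpa using hs.2)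
    simpa [he] using this
  have hrect (T : ℝ) (hT : 0 ≤ T) :
      (∫ s in a..b, g (s + ((-T : ℝ) : ℂ) * Complex.I)) - (∫ s in a..b, g (s + T * Complex.I)) +
        Complex.I • (∫ u in (-T)..T, g (b + u * Complex.I)) -
        Complex.I • (∫ u in (-T)..T, g (a + u * Complex.I)) = 0 := by
    have h := Complex.integral_boundary_rect_eq_zero_of_continuousOn_of_differentiableOn g
      ⟨a, -T⟩ ⟨b, T⟩ ?_ ?_
    · exact h
    · refine hgc.mono fun w hw => ?_
      rw [Complex.mem_reProdIm] at hw
      have := hw.1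
      simp only at this
      rwa [uIcc_of_le hab] at this
    · refine hgd.mono fun w hw => ?_
      rw [Complex.mem_reProdIm] at hw
      have := hw.1
      simp only [min_eq_left hab, max_eq_right hab] at this
      exact this
  have hlimit := (((hside (fun T => -T) (fun T => by ring)).sub (hside id fun T => rfl)).add
    ((hlim b hab le_rfl).const_smul Complex.I)).sub ((hlim a le_rfl hab).const_smul Complex.I)
  have h0 := tendsto_nhds_unique hlimit ((tendsto_congr' (f₂ := fun _ : ℝ => (0 : ℂ)) (by
    filter_upwards [eventually_ge_atTop 0] with T hT using hrect T hT)).2 tendsto_const_nhds)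
  simp only [sub_self, zero_add, ← smul_sub, smul_eq_zero, Complex.I_ne_zero, false_or] at h0
  exact (sub_eq_zero.1 h0).symm

/-- The Gaussian `exp (x y - y² / (2 k))` is a superposition of the exponentials `exp (w y)` with
`w` on an arbitrary vertical line. -/
theorem integral_gaussian_mul_exp {k : ℝ} (hk : 0 < k) (a x y : ℝ) :
    ∫ u : ℝ, Complex.exp (k / 2 * (a + u * Complex.I - x) ^ 2) *
        Complex.exp ((a + u * Complex.I) * y) =
      (√(2 * Real.pi / k) : ℂ) * (Real.exp (x * y - y ^ 2 / (2 * k)) : ℂ) := by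
  have hk' : (k : ℂ) ≠ 0 := by exact_mod_cast hk.ne'
  have h := integral_cexp_quadratic (b := -(k / 2 : ℝ)) (by simpa using hk)
    ((y + k * (a - x)) * Complex.I) (a * y + k / 2 * (a - x) ^ 2)
  have e : (fun u : ℝ => Complex.exp (k / 2 * (a + u * Complex.I - x) ^ 2) *
        Complex.exp ((a + u * Complex.I) * y)) = fun u : ℝ =>
      Complex.exp (-((k / 2 : ℝ) : ℂ) * u ^ 2 + (y + k * (a - x)) * Complex.I * u +
        (a * y + k / 2 * (a - x) ^ 2)) := by
    ext u
    rw [← Complex.exp_add]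
    congr 1
    push_cast
    linear_combination (k / 2 * u ^ 2 : ℂ) * Complex.I_sq
  rw [e, h]
  congr 1
  · rw [neg_neg, Real.sqrt_eq_rpow, Complex.ofReal_cpow (by positivity)]
    push_cast
    congr 1
    field_simp
  · rw [Complex.ofReal_exp]
    congr 1
    push_cast
    rw [mul_pow, Complex.I_sq]
    field_simp
    ring

/-- The Gaussian transform of a measure, expressed by its Laplace transform on a vertical line. -/
theorem integral_gaussian_eq_integral_line {A : Measure ℝ} [SFinite A] {a k : ℝ} (x : ℝ)
    (hk : 0 < k) (hA : Integrable (fun y : ℝ => Real.exp (a * y)) A) :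
    (√(2 * Real.pi / k) : ℂ) * ((∫ y, Real.exp (x * y - y ^ 2 / (2 * k)) ∂A : ℝ) : ℂ) =
      ∫ u : ℝ, Complex.exp (k / 2 * (a + u * Complex.I - x) ^ 2) *
        ∫ y, Complex.exp ((a + u * Complex.I) * y) ∂A := by
  rw [← integral_complex_ofReal, ← integral_const_mul]
  simp_rw [← integral_gaussian_mul_exp hk a, ← integral_const_mul]
  refine integral_integral_swap ?_
  have h := hA.mul_prod ((integrable_exp_neg_half_mul_sq hk).const_mul
    (Real.exp (k / 2 * (a - x) ^ 2)))
  refine h.mono' (Continuous.aestronglyMeasurable (by fun_prop)) (.of_forall fun p => ?_)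
  rw [Function.uncurry, norm_mul, norm_exp_half_mul_sq, Complex.norm_exp]
  simp only [Complex.add_re, Complex.ofReal_re, Complex.mul_re, Complex.I_re, mul_zero,
    Complex.ofReal_im, Complex.I_im, mul_one, sub_self, add_zero, Complex.add_im, Complex.mul_im,
    zero_add, sub_zero]
  rw [mul_sub, sub_eq_add_neg, Real.exp_add, ← neg_mul]
  exact le_of_eq (by ring)

theorem integrable_gaussian_of_integrable_exp {A : Measure ℝ} {a k : ℝ} (x : ℝ)
    (hk : 0 < k) (hA : Integrable (fun y : ℝ => Real.exp (a * y)) A) :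
    Integrable (fun y : ℝ => Real.exp (x * y - y ^ 2 / (2 * k))) A := by
  refine (hA.const_mul (Real.exp (k * (x - a) ^ 2 / 2))).mono'
    (Continuous.aestronglyMeasurable (by fun_prop)) (.of_forall fun y => ?_)
  rw [Real.norm_eq_abs, Real.abs_exp, ← Real.exp_add]
  refine Real.exp_le_exp.2 ?_
  have h : 0 ≤ (k * (x - a) - y) ^ 2 / (2 * k) := by positivity
  have e : (k * (x - a) - y) ^ 2 / (2 * k) =
      k * (x - a) ^ 2 / 2 + a * y - (x * y - y ^ 2 / (2 * k)) := by
    field_simp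
    ring
  linarith

/-! ### Exponential moments of the Lévy process -/

section Moments

variable {μ σ ζ : ℝ} {ν : Measure ℝ}

theorem IsAdmissibleTriplet.norm_exp_mul_laplaceExponent_le (hν : IsAdmissibleTriplet σ ζ ν)
    {t : ℝ} (ht : 0 ≤ t) {w : ℂ} (hw : -ζ ≤ w.re) :
    ‖Complex.exp (t * laplaceExponent μ σ ν w)‖ ≤
      Real.exp (t * realLaplaceExponent μ σ ν w.re) := by
  rw [Complex.norm_exp, Complex.re_ofReal_mul]
  exact Real.exp_le_exp.2 (mul_le_mul_of_nonneg_left (hν.re_laplaceExponent_le hw) ht)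

/-- A law whose characteristic function is `exp (t ψ(i u))` has a finite exponential moment of order
`-ζ`. Shifting the contour from `Re w = 0` to `Re w = -ζ` bounds the Gaussian-damped moments
`∫ exp (-ζ y - y² / (2 k)) dQ` by `exp (t ψ(-ζ))`, and `k → ∞` removes the damping. -/
theorem IsAdmissibleTriplet.integrable_exp_of_charFun (hν : IsAdmissibleTriplet σ ζ ν)
    {Q : Measure ℝ} [IsProbabilityMeasure Q] {t : ℝ} (ht : 0 ≤ t)
    (hQ : ∀ u : ℝ, ∫ y, Complex.exp (u * Complex.I * y) ∂Q =
      Complex.exp (t * laplaceExponent μ σ ν (u * Complex.I))) :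
    Integrable (fun y : ℝ => Real.exp (-ζ * y)) Q := by
  have hζ := hν.zeta_nonneg
  obtain ⟨M, hM⟩ : ∃ M, ∀ s ∈ Icc (-ζ) 0, realLaplaceExponent μ σ ν s ≤ M := by
    obtain ⟨M, hM⟩ := (isCompact_Icc (a := -ζ) (b := 0)).bddAbove_image
      (hν.continuousOn_realLaplaceExponent (μ := μ) |>.mono Icc_subset_Ici_self)
    exact ⟨M, fun s hs => hM (mem_image_of_mem _ hs)⟩
  set E : ℝ := Real.exp (t * realLaplaceExponent μ σ ν (-ζ))
  have hdamped (k : ℝ) (hk : 0 < k) :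
      ∫ y, Real.exp (-ζ * y - y ^ 2 / (2 * k)) ∂Q ≤ E := by
    have h1 := integral_gaussian_eq_integral_line (A := Q) (a := 0) (-ζ) hk (by simp)
    -- the weight is centred at `-ζ`, hence real and positive on the line `Re w = -ζ`
    have h2 := integral_gaussian_mul_eq_of_strip
      (f := fun w => Complex.exp (t * laplaceExponent μ σ ν w)) (a := -ζ) (b := 0)
      (M := Real.exp (t * M)) (-ζ) (by linarith) hk ?_ ?_ ?_
    · simp only [Complex.ofReal_zero, zero_add] at h1 h2
      simp_rw [hQ] at h1
      rw [← h2] at h1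
      have h3 : ‖∫ u : ℝ, Complex.exp (k / 2 * (((-ζ : ℝ) : ℂ) + u * Complex.I - (-ζ : ℝ)) ^ 2) *
          Complex.exp (t * laplaceExponent μ σ ν ((-ζ : ℝ) + u * Complex.I))‖ ≤
          ∫ u : ℝ, Real.exp (-(k / 2) * u ^ 2) * E := by
        refine norm_integral_le_of_norm_le ((integrable_exp_neg_half_mul_sq hk).mul_const E)
          (.of_forall fun u => ?_)
        rw [norm_mul, norm_exp_half_mul_sq]
        have h4 := hν.norm_exp_mul_laplaceExponent_le (μ := μ) ht
          (w := (-ζ : ℝ) + u * Complex.I) (by simp)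
        have h5 : ((-ζ : ℝ) + u * Complex.I : ℂ).re = -ζ := by simp
        have h6 : ((-ζ : ℝ) + u * Complex.I : ℂ).im = u := by simp
        rw [h5] at h4
        rw [h5, h6, sub_self, zero_pow two_ne_zero, zero_sub, mul_neg, ← neg_mul]
        gcongr
      rw [← h1, integral_mul_const, integral_gaussian, norm_mul, Complex.norm_real,
        Complex.norm_real, Real.norm_of_nonneg (Real.sqrt_nonneg _),
        Real.norm_of_nonneg (integral_nonneg fun _ => (Real.exp_pos _).le)] at h3
      have h7 : Real.pi / (k / 2) = 2 * Real.pi / k := by field_simp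
      rw [h7] at h3
      exact le_of_mul_le_mul_left h3 (Real.sqrt_pos.2 (by positivity))
    · exact (continuousOn_const.mul (hν.continuousOn_laplaceExponent.mono fun w hw => hw.1)).cexp
    · exact ((hν.differentiableOn_laplaceExponent.mono fun w hw => hw.1).const_mul _).cexp
    · intro w h1 h2
      refine (hν.norm_exp_mul_laplaceExponent_le ht h1).trans (Real.exp_le_exp.2 ?_)
      exact mul_le_mul_of_nonneg_left (hM _ ⟨h1, h2⟩) ht
  have hfatou : ∫⁻ y, ENNReal.ofReal (Real.exp (-ζ * y)) ∂Q ≤ ENNReal.ofReal E := by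
    have hlim (y : ℝ) : Tendsto (fun n : ℕ => ENNReal.ofReal
        (Real.exp (-ζ * y - y ^ 2 / (2 * ((n : ℝ) + 1))))) atTop
        (𝓝 (ENNReal.ofReal (Real.exp (-ζ * y)))) := by
      refine ENNReal.tendsto_ofReal ((Real.continuous_exp.tendsto _).comp ?_)
      have : Tendsto (fun n : ℕ => y ^ 2 / 2 * (1 / ((n : ℝ) + 1))) atTop (𝓝 (y ^ 2 / 2 * 0)) :=
        tendsto_one_div_add_atTop_nhds_zero_nat.const_mul _
      have h2 := (tendsto_const_nhds (x := -ζ * y)).sub this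
      simp only [mul_zero, sub_zero] at h2
      refine h2.congr fun n => ?_
      field_simp
    calc ∫⁻ y, ENNReal.ofReal (Real.exp (-ζ * y)) ∂Q
        = ∫⁻ y, liminf (fun n : ℕ => ENNReal.ofReal
            (Real.exp (-ζ * y - y ^ 2 / (2 * ((n : ℝ) + 1))))) atTop ∂Q :=
          lintegral_congr fun y => (hlim y).liminf_eq.symm
      _ ≤ liminf (fun n : ℕ => ∫⁻ y, ENNReal.ofReal
            (Real.exp (-ζ * y - y ^ 2 / (2 * ((n : ℝ) + 1)))) ∂Q) atTop :=
          lintegral_liminf_le fun n => by fun_prop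
      _ ≤ ENNReal.ofReal E := by
          refine liminf_le_of_le (by isBoundedDefault) fun b hb => ?_
          obtain ⟨n, hn⟩ := hb.exists
          refine hn.trans ?_
          rw [← ofReal_integral_eq_lintegral_ofReal
            (integrable_gaussian_of_integrable_exp (a := 0) _ (by positivity) (by simp))
            (.of_forall fun _ => (Real.exp_pos _).le)]
          exact ENNReal.ofReal_le_ofReal (hdamped _ (by positivity))
  refine ⟨by fun_prop, ?_⟩
  rw [hasFiniteIntegral_iff_ofReal (.of_forall fun _ => (Real.exp_pos _).le)]
  exact hfatou.trans_lt ENNReal.ofReal_lt_top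

variable {Ω : Type*} [MeasurableSpace Ω] {P : Measure Ω} [IsProbabilityMeasure P]
  {X : ℝ≥0 → Ω → ℝ}

theorem HasLaplaceExponent.integrable_exp_neg_mul (hψ : HasLaplaceExponent X P μ σ ν)
    (hν : IsAdmissibleTriplet σ ζ ν) (hX : IsLevyProcess X P) (t : ℝ≥0) :
    Integrable (fun ω => Real.exp (-ζ * X t ω)) P := by
  have hm := (hX.measurable t).aemeasurable (μ := P)
  have := Measure.isProbabilityMeasure_map hm
  have h := hν.integrable_exp_of_charFun (μ := μ) (Q := P.map (X t)) t.2 fun u => ?_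
  · exact (integrable_map_measure (by fun_prop) hm).1 h
  · rw [integral_map hm (by fun_prop)]
    refine hψ t (u * Complex.I) ?_ ?_
    · refine (integrable_const (1 : ℝ)).mono' (by have := hX.measurable t; fun_prop)
        (.of_forall fun ω => ?_)
      rw [Complex.norm_exp]
      simp
    · exact hν.integrableOn_jumpIntegrand (w := u * Complex.I) (by simpa using hν.zeta_nonneg)

/-- The Laplace transform of the law of `X t` on the line `Re w = -ζ`. -/
theorem HasLaplaceExponent.integral_cexp (hψ : HasLaplaceExponent X P μ σ ν)
    (hν : IsAdmissibleTriplet σ ζ ν) (hX : IsLevyProcess X P) (t : ℝ≥0) {w : ℂ}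
    (hw : w.re = -ζ) :
    ∫ ω, Complex.exp (w * X t ω) ∂P = Complex.exp (t * laplaceExponent μ σ ν w) := by
  refine hψ t w ?_ (hν.integrableOn_jumpIntegrand hw.ge)
  refine (hψ.integrable_exp_neg_mul hν hX t).mono' (by have := hX.measurable t; fun_prop)
    (.of_forall fun ω => le_of_eq ?_)
  rw [Complex.norm_exp, Complex.re_mul_ofReal, hw]

theorem HasLaplaceExponent.integral_exp_neg_mul (hψ : HasLaplaceExponent X P μ σ ν)
    (hν : IsAdmissibleTriplet σ ζ ν) (hX : IsLevyProcess X P) (t : ℝ≥0) :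
    ∫ ω, Real.exp (-ζ * X t ω) ∂P = Real.exp (t * realLaplaceExponent μ σ ν (-ζ)) := by
  have h := hψ.integral_cexp hν hX t (w := ((-ζ : ℝ) : ℂ)) (by simp)
  rw [laplaceExponent_ofReal] at h
  have e : ∀ ω, Complex.exp (((-ζ : ℝ) : ℂ) * X t ω) = ((Real.exp (-ζ * X t ω) : ℝ) : ℂ) := by
    intro ω
    push_cast
    rfl
  simp_rw [e] at h
  rw [integral_complex_ofReal] at h
  exact_mod_cast h

end Moments

/-! ### The potential measure -/

section Exponential

/-- The measure `e^{-q t} dt` on `(0, ∞)`. -/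
noncomputable def expDensityMeasure (q : ℝ) : Measure ℝ :=
  (volume.restrict (Ioi 0)).withDensity fun t => ENNReal.ofReal (Real.exp (-q * t))

instance (q : ℝ) : SFinite (expDensityMeasure q) := by
  unfold expDensityMeasure
  infer_instance

theorem ae_pos_expDensityMeasure (q : ℝ) : ∀ᵐ t ∂expDensityMeasure q, 0 < t :=
  (withDensity_absolutelyContinuous _ _).ae_le (ae_restrict_mem measurableSet_Ioi)

theorem integrable_expDensityMeasure_iff {E : Type*} [NormedAddCommGroup E] [NormedSpace ℝ E]
    {q : ℝ} {g : ℝ → E} : Integrable g (expDensityMeasure q) ↔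
      IntegrableOn (fun t => Real.exp (-q * t) • g t) (Ioi 0) := by
  unfold expDensityMeasure
  rw [integrable_withDensity_iff_integrable_smul' (by fun_prop) (.of_forall fun _ => by simp)]
  simp_rw [ENNReal.toReal_ofReal (Real.exp_pos _).le]
  rfl

theorem integral_expDensityMeasure {E : Type*} [NormedAddCommGroup E] [NormedSpace ℝ E]
    (q : ℝ) (g : ℝ → E) :
    ∫ t, g t ∂expDensityMeasure q = ∫ t in Ioi (0 : ℝ), Real.exp (-q * t) • g t := by
  unfold expDensityMeasure
  rw [integral_withDensity_eq_integral_toReal_smul (by fun_prop) (.of_forall fun _ => by simp)]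
  simp_rw [ENNReal.toReal_ofReal (Real.exp_pos _).le]

theorem integrable_exp_mul_expDensityMeasure {q s : ℝ} (h : s < q) :
    Integrable (fun t => Real.exp (s * t)) (expDensityMeasure q) := by
  rw [integrable_expDensityMeasure_iff]
  refine (integrableOn_exp_mul_Ioi (a := s - q) (by linarith) 0).congr_fun (fun t _ => ?_)
    measurableSet_Ioi
  simp only [smul_eq_mul]
  rw [← Real.exp_add]
  ring_nf

theorem isFiniteMeasure_expDensityMeasure {q : ℝ} (hq : 0 < q) :
    IsFiniteMeasure (expDensityMeasure q) := by
  have h := integrable_exp_mul_expDensityMeasure hq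
  simp only [zero_mul, Real.exp_zero] at h
  exact (integrable_const_iff_isFiniteMeasure one_ne_zero).1 h

theorem integral_cexp_mul_expDensityMeasure {q : ℝ} {w : ℂ} (h : w.re < q) :
    ∫ t, Complex.exp (w * t) ∂expDensityMeasure q = 1 / (q - w) := by
  rw [integral_expDensityMeasure]
  have e (t : ℝ) : Real.exp (-q * t) • Complex.exp (w * t) = Complex.exp ((w - q) * t) := by
    rw [Complex.real_smul, Complex.ofReal_exp, ← Complex.exp_add]
    push_cast
    ring_nf
  simp_rw [e]
  rw [integral_exp_mul_complex_Ioi (by simpa using h)]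
  rw [Complex.ofReal_zero, mul_zero, Complex.exp_zero, neg_div, ← div_neg, neg_sub]

end Exponential

section Payoff

variable {ζ : ℝ} {h : ℝ → ℝ} {hhat : ℝ → ℂ}

theorem IsAdmissiblePayoff.ofReal_eq (hh : IsAdmissiblePayoff ζ h hhat) (y : ℝ) :
    (h y : ℂ) = ∫ z : ℝ, Complex.exp ((-ζ - Complex.I * z) * y) * hhat z := by
  have e (z : ℝ) : Complex.exp ((-ζ - Complex.I * z) * y) * hhat z =
      (Real.exp (-ζ * y) : ℂ) * (Complex.exp (-(Complex.I * y * z)) * hhat z) := by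
    rw [← mul_assoc, Complex.ofReal_exp, ← Complex.exp_add]
    push_cast
    ring_nf
  simp_rw [e]
  rw [integral_const_mul, ← hh.fourier y, ← Complex.ofReal_mul, ← mul_assoc, ← Real.exp_add]
  simp

theorem norm_exp_line (ζ z y : ℝ) :
    ‖Complex.exp ((-ζ - Complex.I * z) * y)‖ = Real.exp (-ζ * y) := by
  rw [Complex.norm_exp, Complex.re_mul_ofReal, re_neg_sub_I_mul]

theorem IsAdmissiblePayoff.abs_le (hh : IsAdmissiblePayoff ζ h hhat) (y : ℝ) :
    |h y| ≤ Real.exp (-ζ * y) * ∫ z, ‖hhat z‖ := by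
  rw [← Real.norm_eq_abs, ← Complex.norm_real, hh.ofReal_eq, ← integral_const_mul]
  refine (norm_integral_le_integral_norm _).trans (le_of_eq (integral_congr_ae ?_))
  exact .of_forall fun z => by simp only [norm_mul, norm_exp_line]

theorem IsAdmissiblePayoff.continuous (hh : IsAdmissiblePayoff ζ h hhat) : Continuous h := by
  have h1 : Continuous fun y : ℝ => ∫ z : ℝ, Complex.exp (-(Complex.I * y * z)) * hhat z := by
    refine continuous_of_dominated (bound := fun z => ‖hhat z‖) (fun y => ?_) (fun y => ?_)
      hh.integrable.norm ?_
    · exact AEStronglyMeasurable.mul (by fun_prop) hh.integrable.aestronglyMeasurable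
    · refine .of_forall fun z => ?_
      rw [norm_mul, Complex.norm_exp]
      simp
    · exact .of_forall fun z => by fun_prop
  have h2 : h = fun y => Real.exp (-ζ * y) *
      (∫ z : ℝ, Complex.exp (-(Complex.I * y * z)) * hhat z).re := by
    ext y
    rw [← hh.fourier y, Complex.ofReal_re, ← mul_assoc, ← Real.exp_add]
    simp
  rw [h2]
  exact Continuous.mul (by fun_prop) (Complex.continuous_re.comp h1)

variable {A : Measure ℝ}

theorem IsAdmissiblePayoff.integrable_of_integrable_exp (hh : IsAdmissiblePayoff ζ h hhat)
    (hA : Integrable (fun y : ℝ => Real.exp (-ζ * y)) A) : Integrable h A :=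
  (hA.mul_const (∫ z, ‖hhat z‖)).mono' hh.continuous.aestronglyMeasurable
    (.of_forall fun y => hh.abs_le y)

/-- The integral of the payoff is the integral of `hhat` against the Laplace transform of the
measure on the line `Re w = -ζ`. -/
theorem IsAdmissiblePayoff.integral_eq [SFinite A] (hh : IsAdmissiblePayoff ζ h hhat)
    (hA : Integrable (fun y : ℝ => Real.exp (-ζ * y)) A) :
    ((∫ y, h y ∂A : ℝ) : ℂ) =
      ∫ z : ℝ, (∫ y, Complex.exp ((-ζ - Complex.I * z) * y) ∂A) * hhat z := by
  rw [← integral_complex_ofReal]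
  simp_rw [hh.ofReal_eq, ← integral_mul_const]
  refine integral_integral_swap ?_
  refine (hA.mul_prod hh.integrable.norm).mono' ?_ (.of_forall fun p => ?_)
  · exact AEStronglyMeasurable.mul (by fun_prop) hh.integrable.aestronglyMeasurable.comp_snd
  · rw [Function.uncurry, norm_mul, norm_exp_line]

/-- Because the payoff vanishes on `[0, ∞)`, the second term of the extension kernel does not
contribute. -/
theorem IsAdmissiblePayoff.integral_inv_eq_zero (hh : IsAdmissiblePayoff ζ h hhat) {l : ℝ}
    (hl : -ζ < l) : ∫ z : ℝ, 1 / ((l : ℂ) + ζ + Complex.I * z) * hhat z = 0 := by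
  have h1 := hh.integral_eq (integrable_exp_mul_expDensityMeasure hl)
  have h2 : ∫ y, h y ∂expDensityMeasure l = 0 := by
    refine integral_eq_zero_of_ae ?_
    filter_upwards [ae_pos_expDensityMeasure l] with y hy
    by_contra hne
    exact lt_asymm hy (hh.support_subset hne)
  rw [h2, Complex.ofReal_zero] at h1
  rw [h1]
  refine integral_congr_ae (.of_forall fun z => ?_)
  simp only
  rw [integral_cexp_mul_expDensityMeasure (by simpa using hl)]
  ring_nf

end Payoff

section Potential

variable {Ω : Type*} [MeasurableSpace Ω] {P : Measure Ω} {X : ℝ≥0 → Ω → ℝ}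

/-- A process with almost surely right-continuous paths is jointly measurable up to a null set: it
is the limit of its discretisations along the times `(⌊n t⌋ + 1) / n`. -/
theorem IsLevyProcess.aemeasurable_uncurry [IsProbabilityMeasure P] (hX : IsLevyProcess X P)
    (m : Measure ℝ) [SFinite m] :
    AEMeasurable (fun p : Ω × ℝ => X p.2.toNNReal p.1) (P.prod m) := by
  refine aemeasurable_of_tendsto_metrizable_ae atTop
    (f := fun (n : ℕ) (p : Ω × ℝ) =>
      X ((⌊p.2.toNNReal * (n + 1)⌋₊ + 1 : ℝ≥0) / (n + 1)) p.1) (fun n => ?_) ?_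
  · have h1 : Measurable fun q : Ω × ℕ => X (((q.2 : ℝ≥0) + 1) / ((n : ℝ≥0) + 1)) q.1 :=
      measurable_from_prod_countable_left fun k =>
        hX.measurable (((k : ℝ≥0) + 1) / ((n : ℝ≥0) + 1))
    have h2 : Measurable fun p : Ω × ℝ => (p.1, ⌊p.2.toNNReal * ((n : ℝ≥0) + 1)⌋₊) := by
      fun_prop
    exact (h1.comp h2).aemeasurable
  · have hae := Measure.quasiMeasurePreserving_fst (μ := P) (ν := m) |>.ae hX.cadlag
    filter_upwards [hae] with p hp
    set t := p.2.toNNReal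
    refine (hp t).1.tendsto.comp (tendsto_nhdsWithin_iff.2 ⟨?_, .of_forall fun n => ?_⟩)
    · refine tendsto_of_tendsto_of_tendsto_of_le_of_le tendsto_const_nhds
        (h := fun n : ℕ => t + 1 / ((n : ℝ≥0) + 1)) ?_ (fun n => ?_) (fun n => ?_)
      · have := (tendsto_const_nhds (x := t)).add
          (tendsto_one_div_add_atTop_nhds_zero_nat (𝕜 := ℝ≥0))
        simpa using this
      · show t ≤ _
        rw [le_div_iff₀ (by positivity)]
        exact (Nat.lt_floor_add_one _).le
      · show _ ≤ t + 1 / ((n : ℝ≥0) + 1)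
        rw [div_le_iff₀ (by positivity), add_mul, one_div_mul_cancel (by positivity)]
        gcongr
        exact Nat.floor_le (by positivity)
    · show t ≤ _
      rw [le_div_iff₀ (by positivity)]
      exact (Nat.lt_floor_add_one _).le

/-- The `q`-potential measure `E ∫_0^∞ e^{-q t} 1_{X_t ∈ ·} dt`. -/
noncomputable def potentialMeasure (X : ℝ≥0 → Ω → ℝ) (P : Measure Ω) (q : ℝ) : Measure ℝ :=
  (P.prod (expDensityMeasure q)).map fun p => X p.2.toNNReal p.1

variable [IsProbabilityMeasure P] {μ σ ζ : ℝ} {ν : Measure ℝ} {q : ℝ}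

theorem isFiniteMeasure_potentialMeasure (hq : 0 < q) :
    IsFiniteMeasure (potentialMeasure X P q) := by
  have := isFiniteMeasure_expDensityMeasure hq
  unfold potentialMeasure
  infer_instance

theorem HasLaplaceExponent.integrable_exp_prod (hψ : HasLaplaceExponent X P μ σ ν)
    (hν : IsAdmissibleTriplet σ ζ ν) (hX : IsLevyProcess X P)
    (hq : realLaplaceExponent μ σ ν (-ζ) < q) :
    Integrable (fun p : Ω × ℝ => Real.exp (-ζ * X p.2.toNNReal p.1))
      (P.prod (expDensityMeasure q)) := by
  have hm : AEStronglyMeasurable (fun p : Ω × ℝ => Real.exp (-ζ * X p.2.toNNReal p.1))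
      (P.prod (expDensityMeasure q)) := by
    have := hX.aemeasurable_uncurry (expDensityMeasure q)
    exact (Real.measurable_exp.comp_aemeasurable (this.const_mul (-ζ))).aestronglyMeasurable
  rw [integrable_prod_iff' hm]
  refine ⟨.of_forall fun t => hψ.integrable_exp_neg_mul hν hX t.toNNReal, ?_⟩
  refine (integrable_exp_mul_expDensityMeasure hq).congr ?_
  filter_upwards [ae_pos_expDensityMeasure q] with t ht
  simp_rw [Real.norm_eq_abs, Real.abs_exp]
  rw [hψ.integral_exp_neg_mul hν hX, Real.coe_toNNReal t ht.le, mul_comm]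

theorem HasLaplaceExponent.integrable_exp_potentialMeasure (hψ : HasLaplaceExponent X P μ σ ν)
    (hν : IsAdmissibleTriplet σ ζ ν) (hX : IsLevyProcess X P)
    (hq : realLaplaceExponent μ σ ν (-ζ) < q) :
    Integrable (fun y : ℝ => Real.exp (-ζ * y)) (potentialMeasure X P q) := by
  unfold potentialMeasure
  rw [integrable_map_measure (by fun_prop) (hX.aemeasurable_uncurry _)]
  exact hψ.integrable_exp_prod hν hX hq

/-- The Laplace transform of the potential measure on the line `Re w = -ζ`. -/
theorem HasLaplaceExponent.integral_cexp_potentialMeasure (hψ : HasLaplaceExponent X P μ σ ν)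
    (hν : IsAdmissibleTriplet σ ζ ν) (hX : IsLevyProcess X P)
    (hq : realLaplaceExponent μ σ ν (-ζ) < q) {w : ℂ} (hw : w.re = -ζ) :
    ∫ y, Complex.exp (w * y) ∂potentialMeasure X P q = 1 / (q - laplaceExponent μ σ ν w) := by
  have hm := hX.aemeasurable_uncurry (expDensityMeasure q)
  unfold potentialMeasure
  rw [integral_map hm (by fun_prop), integral_prod_symm]
  · rw [← integral_cexp_mul_expDensityMeasure]
    · refine integral_congr_ae ?_
      filter_upwards [ae_pos_expDensityMeasure q] with t ht
      rw [hψ.integral_cexp hν hX _ hw, Real.coe_toNNReal t ht.le, mul_comm]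
    · exact (hν.re_laplaceExponent_le hw.ge).trans_lt (by rwa [hw])
  · refine (hψ.integrable_exp_prod hν hX hq).mono' ?_ (.of_forall fun p => le_of_eq ?_)
    · exact ((Continuous.measurable (f := fun y : ℝ => Complex.exp (w * y))
        (by fun_prop)).comp_aemeasurable hm).aestronglyMeasurable
    · rw [Complex.norm_exp, Complex.re_mul_ofReal, hw]

theorem IsLevyProcess.integrable_potentialMeasure_iff (hX : IsLevyProcess X P) {h : ℝ → ℝ}
    (hh : Measurable h) :
    Integrable h (potentialMeasure X P q) ↔
      Integrable (fun p : Ω × ℝ => Real.exp (-q * p.2) * h (X p.2.toNNReal p.1))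
        (P.prod (volume.restrict (Ioi 0))) := by
  unfold potentialMeasure
  rw [integrable_map_measure hh.aestronglyMeasurable (hX.aemeasurable_uncurry _),
    expDensityMeasure, prod_withDensity_right (by fun_prop),
    integrable_withDensity_iff_integrable_smul' (by fun_prop) (.of_forall fun _ => by simp)]
  simp_rw [ENNReal.toReal_ofReal (Real.exp_pos _).le]
  rfl

theorem IsLevyProcess.integral_potentialMeasure (hX : IsLevyProcess X P) {h : ℝ → ℝ}
    (hh : Measurable h) (hint : Integrable h (potentialMeasure X P q)) :
    ∫ y, h y ∂potentialMeasure X P q = timeLaplace X P h q := by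
  have hm := hX.aemeasurable_uncurry (expDensityMeasure q)
  unfold potentialMeasure at hint ⊢
  rw [integrable_map_measure hh.aestronglyMeasurable hm] at hint
  rw [integral_map hm hh.aestronglyMeasurable]
  refine (integral_prod _ hint).trans ?_
  unfold timeLaplace
  simp_rw [Function.comp_apply, integral_expDensityMeasure, smul_eq_mul]

end Potential

/-! ### The pole of the resolvent transform -/

section Pole

variable {μ σ ζ : ℝ} {ν : Measure ℝ} {l : ℝ}

/-- All difference quotients of the Laplace exponent with one end at `l` and the other in the
half-plane `Re w ≥ -ζ` have real part at least `1`. This holds for all large `l`. -/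
def HasSlopeBound (μ σ ζ : ℝ) (ν : Measure ℝ) (l : ℝ) : Prop :=
  ∀ w : ℂ, -ζ ≤ w.re → w ≠ l →
    1 ≤ ((laplaceExponent μ σ ν l - laplaceExponent μ σ ν w) / (l - w)).re

theorem IsAdmissibleTriplet.eventually_hasSlopeBound (hν : IsAdmissibleTriplet σ ζ ν) (μ : ℝ) :
    ∀ᶠ l : ℝ in atTop, 0 < l ∧ HasSlopeBound μ σ ζ ν l := by
  obtain ⟨R, hR, h⟩ := hν.exists_le_re_slope μ
  filter_upwards [eventually_ge_atTop R] with l hl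
  exact ⟨by linarith, fun w hw hne => h l w (by simpa using hl) hw hne.symm⟩

theorem HasSlopeBound.norm_sub_le_norm_laplaceExponent_sub (hl : HasSlopeBound μ σ ζ ν l)
    {w : ℂ} (hw : -ζ ≤ w.re) :
    ‖w - l‖ ≤ ‖laplaceExponent μ σ ν w - realLaplaceExponent μ σ ν l‖ := by
  rcases eq_or_ne w l with rfl | hne
  · simp
  have h1 := (hl w hw hne).trans (Complex.re_le_norm _)
  rwa [norm_div, le_div_iff₀ (norm_pos_iff.2 (sub_ne_zero.2 hne.symm)), one_mul,
    norm_sub_rev _ w, norm_sub_rev _ (laplaceExponent μ σ ν w), laplaceExponent_ofReal] at h1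

theorem HasSlopeBound.one_le_slope (hl : HasSlopeBound μ σ ζ ν l) {s : ℝ} (hs : -ζ ≤ s)
    (hne : s ≠ l) :
    1 ≤ (realLaplaceExponent μ σ ν l - realLaplaceExponent μ σ ν s) / (l - s) := by
  have h := hl s (by simpa using hs) (by exact_mod_cast hne)
  rw [laplaceExponent_ofReal, laplaceExponent_ofReal] at h
  norm_cast at h

theorem HasSlopeBound.add_le (hl : HasSlopeBound μ σ ζ ν l) {s : ℝ} (hs : -ζ ≤ s) (hsl : s < l) :
    realLaplaceExponent μ σ ν s + (l - s) ≤ realLaplaceExponent μ σ ν l := by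
  have h := hl.one_le_slope hs hsl.ne
  rw [le_div_iff₀ (by linarith)] at h
  linarith

theorem realLaplaceExponent_zero : realLaplaceExponent μ σ ν 0 = 0 := by
  simp [realLaplaceExponent]

/-- Because of the slope bound, `l` is the only nonnegative point at which the Laplace exponent
takes the value `ψ(l)`. -/
theorem HasSlopeBound.rightInverse_eq (hl : HasSlopeBound μ σ ζ ν l) (hζ : 0 ≤ ζ) (hl0 : 0 < l) :
    rightInverse μ σ ν (realLaplaceExponent μ σ ν l) = l := by
  have : {s : ℝ | 0 ≤ s ∧ realLaplaceExponent μ σ ν s = realLaplaceExponent μ σ ν l} = {l} := by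
    ext s
    refine ⟨fun ⟨h0, hs⟩ => ?_, fun hs => ?_⟩
    · by_contra hne
      have := hl.one_le_slope (s := s) (by linarith) hne
      rw [hs, sub_self, zero_div] at this
      linarith
    · rw [mem_singleton_iff] at hs
      exact ⟨hs ▸ hl0.le, by rw [hs]⟩
  rw [rightInverse, this, csSup_singleton]

theorem dslope_eq_div {f : ℂ → ℂ} {a w : ℂ} (h : w ≠ a) :
    dslope f a w = (f w - f a) / (w - a) := by
  rw [dslope_of_ne _ h, slope_def_field]

/-- At `w = l` the bound passes to the limit of the difference quotients. -/
theorem HasSlopeBound.one_le_re_dslope (hl : HasSlopeBound μ σ ζ ν l)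
    (hν : IsAdmissibleTriplet σ ζ ν) (hl0 : -ζ < l) {w : ℂ} (hw : -ζ ≤ w.re) :
    1 ≤ (dslope (laplaceExponent μ σ ν) l w).re := by
  have hne (w : ℂ) (hw : -ζ ≤ w.re) (h : w ≠ l) :
      1 ≤ (dslope (laplaceExponent μ σ ν) l w).re := by
    rw [dslope_eq_div h, ← neg_div_neg_eq, neg_sub, neg_sub]
    exact hl w hw h
  rcases eq_or_ne w l with rfl | h
  · have hl' : -ζ < (l : ℂ).re := by simpa using hl0
    have hcont : ContinuousAt (dslope (laplaceExponent μ σ ν) l) l :=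
      continuousAt_dslope_same.2 (hν.differentiableAt_laplaceExponent hl')
    have ht := (Complex.continuous_re.continuousAt.comp hcont).tendsto.mono_left
      (nhdsWithin_le_nhds (s := {(l : ℂ)}ᶜ))
    refine ge_of_tendsto ht ?_
    filter_upwards [self_mem_nhdsWithin,
      nhdsWithin_le_nhds ((isOpen_re_gt (-ζ)).mem_nhds hl')] with v hv hv'
    exact hne v (le_of_lt hv') hv
  · exact hne w hw h

theorem HasSlopeBound.one_le_deriv (hl : HasSlopeBound μ σ ζ ν l)
    (hν : IsAdmissibleTriplet σ ζ ν) (hl0 : -ζ < l) :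
    1 ≤ deriv (realLaplaceExponent μ σ ν) l := by
  have h := hl.one_le_re_dslope hν hl0 (w := (l : ℂ)) (by simpa using hl0.le)
  rwa [dslope_same, hν.deriv_laplaceExponent_ofReal hl0, Complex.ofReal_re] at h

/-- The function `1 / (ψ(w) - ψ(l)) - 1 / (ψ'(l) (w - l))` with its removable singularity at `w = l`
filled in. -/
noncomputable def regularizedResolvent (μ σ : ℝ) (ν : Measure ℝ) (l : ℝ) (w : ℂ) : ℂ :=
  -dslope (dslope (laplaceExponent μ σ ν) l) l w /
    (dslope (laplaceExponent μ σ ν) l w * deriv (realLaplaceExponent μ σ ν) l)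

theorem HasSlopeBound.dslope_ne_zero (hl : HasSlopeBound μ σ ζ ν l)
    (hν : IsAdmissibleTriplet σ ζ ν) (hl0 : -ζ < l) {w : ℂ} (hw : -ζ ≤ w.re) :
    dslope (laplaceExponent μ σ ν) l w ≠ 0 := fun h => by
  have := hl.one_le_re_dslope hν hl0 hw
  rw [h, Complex.zero_re] at this
  linarith

theorem HasSlopeBound.deriv_ne_zero (hl : HasSlopeBound μ σ ζ ν l)
    (hν : IsAdmissibleTriplet σ ζ ν) (hl0 : -ζ < l) :
    ((deriv (realLaplaceExponent μ σ ν) l : ℝ) : ℂ) ≠ 0 := by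
  have := hl.one_le_deriv hν hl0
  exact_mod_cast (by linarith : (0 : ℝ) < _).ne'

theorem HasSlopeBound.regularizedResolvent_eq (hl : HasSlopeBound μ σ ζ ν l)
    (hν : IsAdmissibleTriplet σ ζ ν) (hl0 : -ζ < l) {w : ℂ} (hw : -ζ ≤ w.re) (hne : w ≠ l) :
    regularizedResolvent μ σ ν l w =
      1 / (laplaceExponent μ σ ν w - realLaplaceExponent μ σ ν l) -
        1 / (deriv (realLaplaceExponent μ σ ν) l * (w - l)) := by
  have h1 := hl.dslope_ne_zero hν hl0 hw
  have h2 := hl.deriv_ne_zero hν hl0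
  have h3 : w - l ≠ 0 := sub_ne_zero.2 hne
  rw [regularizedResolvent, dslope_eq_div hne, dslope_same, hν.deriv_laplaceExponent_ofReal hl0]
  have e : laplaceExponent μ σ ν w - realLaplaceExponent μ σ ν l =
      dslope (laplaceExponent μ σ ν) l w * (w - l) := by
    rw [dslope_eq_div hne, div_mul_cancel₀ _ h3, laplaceExponent_ofReal]
  rw [e]
  field_simp
  ring

theorem HasSlopeBound.differentiableOn_regularizedResolvent (hl : HasSlopeBound μ σ ζ ν l)
    (hν : IsAdmissibleTriplet σ ζ ν) (hl0 : -ζ < l) :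
    DifferentiableOn ℂ (regularizedResolvent μ σ ν l) {w : ℂ | -ζ < w.re} := by
  have hmem : {w : ℂ | -ζ < w.re} ∈ 𝓝 (l : ℂ) := (isOpen_re_gt _).mem_nhds (by simpa using hl0)
  have h1 := (Complex.differentiableOn_dslope hmem).2
    (hν.differentiableOn_laplaceExponent (μ := μ))
  have h2 := (Complex.differentiableOn_dslope hmem).2 h1
  exact h2.neg.div (h1.mul_const _) fun w hw =>
    mul_ne_zero (hl.dslope_ne_zero hν hl0 (le_of_lt hw)) (hl.deriv_ne_zero hν hl0)

theorem HasSlopeBound.continuousOn_regularizedResolvent (hl : HasSlopeBound μ σ ζ ν l)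
    (hν : IsAdmissibleTriplet σ ζ ν) (hl0 : -ζ < l) :
    ContinuousOn (regularizedResolvent μ σ ν l) {w : ℂ | -ζ ≤ w.re} := by
  have hmem : {w : ℂ | -ζ < w.re} ∈ 𝓝 (l : ℂ) := (isOpen_re_gt _).mem_nhds (by simpa using hl0)
  have hmem' : {w : ℂ | -ζ ≤ w.re} ∈ 𝓝 (l : ℂ) :=
    mem_of_superset hmem fun w (hw : -ζ < w.re) => hw.le
  have hd := hν.differentiableOn_laplaceExponent (μ := μ)
  have h1 := (continuousOn_dslope hmem').2
    ⟨hν.continuousOn_laplaceExponent (μ := μ), hd.differentiableAt hmem⟩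
  have h2 := (continuousOn_dslope hmem').2
    ⟨h1, ((Complex.differentiableOn_dslope hmem).2 hd).differentiableAt hmem⟩
  exact h2.neg.div (h1.mul continuousOn_const) fun w hw =>
    mul_ne_zero (hl.dslope_ne_zero hν hl0 hw) (hl.deriv_ne_zero hν hl0)

/-- Near `l` the bound comes from compactness, elsewhere from the slope bound. -/
theorem HasSlopeBound.exists_norm_regularizedResolvent_le (hl : HasSlopeBound μ σ ζ ν l)
    (hν : IsAdmissibleTriplet σ ζ ν) (hl0 : -ζ < l) :
    ∃ M, ∀ w : ℂ, -ζ ≤ w.re → ‖regularizedResolvent μ σ ν l w‖ ≤ M := by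
  have hcpt : IsCompact (Metric.closedBall (l : ℂ) 1 ∩ {w : ℂ | -ζ ≤ w.re}) :=
    (isCompact_closedBall _ _).inter_right (isClosed_le continuous_const Complex.continuous_re)
  obtain ⟨M, hM⟩ := hcpt.exists_bound_of_continuousOn
    ((hl.continuousOn_regularizedResolvent hν hl0).mono inter_subset_right)
  refine ⟨max M 2, fun w hw => ?_⟩
  by_cases hwl : w ∈ Metric.closedBall (l : ℂ) 1
  · exact (hM w ⟨hwl, hw⟩).trans (le_max_left _ _)
  · refine le_trans ?_ (le_max_right _ _)
    rw [Metric.mem_closedBall, dist_eq_norm, not_le] at hwl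
    have hne : w ≠ l := by
      rintro rfl
      simp at hwl
      linarith
    rw [hl.regularizedResolvent_eq hν hl0 hw hne]
    have h1 := hl.norm_sub_le_norm_laplaceExponent_sub hw
    have h2 := hl.one_le_deriv hν hl0
    refine (norm_sub_le _ _).trans ?_
    rw [norm_div, norm_div, norm_one, norm_mul, Complex.norm_real,
      Real.norm_of_nonneg (by linarith)]
    have h3 : 1 / ‖laplaceExponent μ σ ν w - realLaplaceExponent μ σ ν l‖ ≤ 1 :=
      (div_le_one (by linarith)).2 (by linarith)
    have h4 : 1 / (deriv (realLaplaceExponent μ σ ν) l * ‖w - l‖) ≤ 1 :=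
      (div_le_one (by positivity)).2 (by nlinarith)
    linarith

end Pole

/-! ### Identification of the potential measure -/

/-- Measures with finite Gaussian transforms are determined by them: after multiplication by the
density `exp (-y² / 2)` the transform becomes the moment generating function. -/
theorem ext_of_gaussian_transform {A₁ A₂ : Measure ℝ}
    (h₁ : ∀ x : ℝ, Integrable (fun y : ℝ => Real.exp (x * y - y ^ 2 / 2)) A₁)
    (h₂ : ∀ x : ℝ, Integrable (fun y : ℝ => Real.exp (x * y - y ^ 2 / 2)) A₂)
    (heq : ∀ x : ℝ, ∫ y, Real.exp (x * y - y ^ 2 / 2) ∂A₁ =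
      ∫ y, Real.exp (x * y - y ^ 2 / 2) ∂A₂) : A₁ = A₂ := by
  set d : ℝ → ℝ≥0∞ := fun y => ENNReal.ofReal (Real.exp (-(y ^ 2 / 2))) with hd
  have hdm : Measurable d := by fun_prop
  have hsmul (x y : ℝ) : (d y).toReal • Real.exp (x * y) = Real.exp (x * y - y ^ 2 / 2) := by
    rw [hd, ENNReal.toReal_ofReal (Real.exp_pos _).le, smul_eq_mul, ← Real.exp_add]
    ring_nf
  have hint {A : Measure ℝ}
      (h : ∀ x : ℝ, Integrable (fun y : ℝ => Real.exp (x * y - y ^ 2 / 2)) A) (x : ℝ) :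
      Integrable (fun y => Real.exp (x * y)) (A.withDensity d) := by
    rw [integrable_withDensity_iff_integrable_smul' hdm (.of_forall fun _ => by simp [hd])]
    simp_rw [hsmul]
    exact h x
  have hfin {A : Measure ℝ}
      (h : ∀ x : ℝ, Integrable (fun y : ℝ => Real.exp (x * y - y ^ 2 / 2)) A) :
      IsFiniteMeasure (A.withDensity d) := by
    have := hint h 0
    simp only [zero_mul, Real.exp_zero] at this
    exact (integrable_const_iff_isFiniteMeasure one_ne_zero).1 this
  have hmgf (A : Measure ℝ) (x : ℝ) : mgf id (A.withDensity d) x =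
      ∫ y, Real.exp (x * y - y ^ 2 / 2) ∂A := by
    rw [mgf, integral_withDensity_eq_integral_toReal_smul hdm (.of_forall fun _ => by simp [hd])]
    exact integral_congr_ae (.of_forall fun y => hsmul x y)
  have := hfin h₁
  have := hfin h₂
  have hmgf' : mgf id (A₁.withDensity d) = mgf id (A₂.withDensity d) := by
    ext x
    rw [hmgf, hmgf, heq]
  have hzero : A₁.withDensity d = 0 ↔ A₂.withDensity d = 0 := by
    have h0 := congrFun hmgf' 0
    simp only [mgf_zero'] at h0
    rw [← Measure.measure_univ_eq_zero, ← measureReal_eq_zero_iff, h0, measureReal_eq_zero_iff,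
      Measure.measure_univ_eq_zero]
  have hset {A : Measure ℝ}
      (h : ∀ x : ℝ, Integrable (fun y : ℝ => Real.exp (x * y - y ^ 2 / 2)) A) :
      integrableExpSet id (A.withDensity d) = univ :=
    eq_univ_of_forall fun x => hint h x
  have hw : A₁.withDensity d = A₂.withDensity d := by
    refine Measure.ext_of_complexMGF_id_eq (funext fun z => ?_)
    refine eqOn_complexMGF_of_mgf' hmgf' hzero ?_
    simp [hset h₁]
  have hinv (A : Measure ℝ) : (A.withDensity d).withDensity (fun y => (d y)⁻¹) = A :=
    withDensity_inv_same hdm (.of_forall fun y => by simp [hd, Real.exp_pos])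
      (.of_forall fun y => by simp [hd])
  rw [← hinv A₁, hw, hinv]

section Identification

variable {μ σ ζ : ℝ} {ν : Measure ℝ} {l : ℝ} {W : ℝ → ℝ}

/-- The measure `W(-y) dy`. -/
noncomputable def reflectedMeasure (W : ℝ → ℝ) : Measure ℝ :=
  volume.withDensity fun y => ENNReal.ofReal (W (-y))

theorem IsScaleFunction.aemeasurable {q : ℝ} (hW : IsScaleFunction μ σ ν q W) :
    AEMeasurable W := by
  have h := (hW.integrable (rightInverse μ σ ν q + 1) (by linarith)).aestronglyMeasurable
  set a := rightInverse μ σ ν q + 1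
  have h2 : AEMeasurable (fun x => Real.exp (a * x) * (Real.exp (-a * x) * W x)) :=
    AEMeasurable.mul (by fun_prop) h.aemeasurable
  refine h2.congr (.of_forall fun x => ?_)
  simp only
  rw [← mul_assoc, ← Real.exp_add]
  simp

theorem IsScaleFunction.aemeasurable_neg {q : ℝ} (hW : IsScaleFunction μ σ ν q W) :
    AEMeasurable fun y => W (-y) :=
  hW.aemeasurable.comp_quasiMeasurePreserving
    (Measure.measurePreserving_neg volume).quasiMeasurePreserving

theorem IsScaleFunction.integrable_exp_reflectedMeasure {q : ℝ}
    (hW : IsScaleFunction μ σ ν q W) {w : ℝ} (hw : rightInverse μ σ ν q < w) :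
    Integrable (fun y => Real.exp (w * y)) (reflectedMeasure W) := by
  unfold reflectedMeasure
  rw [integrable_withDensity_iff_integrable_smul₀' hW.aemeasurable_neg.ennreal_ofReal
    (.of_forall fun _ => by simp)]
  refine (hW.integrable w hw).comp_neg.congr (.of_forall fun y => ?_)
  simp only [ENNReal.toReal_ofReal (hW.nonneg _), smul_eq_mul]
  ring_nf

theorem IsScaleFunction.integral_exp_reflectedMeasure {q : ℝ}
    (hW : IsScaleFunction μ σ ν q W) {w : ℝ} (hw : rightInverse μ σ ν q < w) :
    ∫ y, Real.exp (w * y) ∂reflectedMeasure W = 1 / (realLaplaceExponent μ σ ν w - q) := by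
  unfold reflectedMeasure
  rw [integral_withDensity_eq_integral_toReal_smul₀ hW.aemeasurable_neg.ennreal_ofReal
    (.of_forall fun _ => by simp), ← hW.laplace w hw,
    ← integral_neg_eq_self (fun x => Real.exp (-w * x) * W x)]
  refine integral_congr_ae (.of_forall fun y => ?_)
  simp only [ENNReal.toReal_ofReal (hW.nonneg _), smul_eq_mul]
  ring_nf

/-- By the identity theorem, the Laplace transform of the scale function is also known at complex
arguments. -/
theorem IsScaleFunction.integral_cexp_reflectedMeasure (hl : HasSlopeBound μ σ ζ ν l)
    (hν : IsAdmissibleTriplet σ ζ ν) (hl0 : 0 < l)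
    (hW : IsScaleFunction μ σ ν (realLaplaceExponent μ σ ν l) W) {w : ℂ} (hw : l < w.re) :
    ∫ y, Complex.exp (w * y) ∂reflectedMeasure W =
      1 / (laplaceExponent μ σ ν w - realLaplaceExponent μ σ ν l) := by
  have hζ := hν.zeta_nonneg
  have hΦ := hl.rightInverse_eq hζ hl0
  have hsub : Ioi l ⊆ integrableExpSet id (reflectedMeasure W) := fun s hs =>
    hW.integrable_exp_reflectedMeasure (by rw [hΦ]; exact hs)
  have h1 : AnalyticOnNhd ℂ (complexMGF id (reflectedMeasure W)) {w : ℂ | l < w.re} :=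
    analyticOnNhd_complexMGF.mono fun w hw => interior_maximal hsub isOpen_Ioi hw
  have hne (w : ℂ) (hw : l < w.re) :
      laplaceExponent μ σ ν w - realLaplaceExponent μ σ ν l ≠ 0 := fun h => by
    have h2 := hl.norm_sub_le_norm_laplaceExponent_sub (w := w) (by linarith)
    rw [h, norm_zero, norm_le_zero_iff, sub_eq_zero] at h2
    rw [h2, Complex.ofReal_re] at hw
    exact lt_irrefl _ hw
  have h2 : AnalyticOnNhd ℂ
      (fun w => 1 / (laplaceExponent μ σ ν w - realLaplaceExponent μ σ ν l))
      {w : ℂ | l < w.re} := by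
    refine DifferentiableOn.analyticOnNhd (DifferentiableOn.div (by fun_prop)
      (DifferentiableOn.sub_const ?_ _) hne) (isOpen_re_gt l)
    exact hν.differentiableOn_laplaceExponent.mono fun w (hw : l < w.re) =>
      show -ζ < w.re by linarith
  have hreal (s : ℝ) (hs : l < s) : complexMGF id (reflectedMeasure W) s =
      1 / (laplaceExponent μ σ ν s - realLaplaceExponent μ σ ν l) := by
    rw [complexMGF_ofReal, laplaceExponent_ofReal, mgf]
    simp only [id]
    rw [hW.integral_exp_reflectedMeasure (by rwa [hΦ])]
    push_cast
    rfl
  have hfreq : ∃ᶠ z in 𝓝[≠] ((l + 1 : ℝ) : ℂ), complexMGF id (reflectedMeasure W) z =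
      1 / (laplaceExponent μ σ ν z - realLaplaceExponent μ σ ν l) := by
    have ht : Tendsto (fun s : ℝ => (s : ℂ)) (𝓝[≠] (l + 1)) (𝓝[≠] ((l + 1 : ℝ) : ℂ)) := by
      refine tendsto_nhdsWithin_iff.2 ⟨(Complex.continuous_ofReal.tendsto _).mono_left
        nhdsWithin_le_nhds, ?_⟩
      filter_upwards [self_mem_nhdsWithin] with s hs
      exact fun h => hs (Complex.ofReal_injective h)
    refine ht.frequently (Eventually.frequently ?_)
    filter_upwards [nhdsWithin_le_nhds (Ioi_mem_nhds (lt_add_one l))] with s hs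
    exact hreal s hs
  exact h1.eqOn_of_preconnected_of_frequently_eq h2 (convex_halfSpace_re_gt l).isPreconnected
    (z₀ := ((l + 1 : ℝ) : ℂ)) (by simp) hfreq hw

end Identification

section Decomposition

variable {Ω : Type*} [MeasurableSpace Ω] {P : Measure Ω} [IsProbabilityMeasure P]
  {X : ℝ≥0 → Ω → ℝ} {μ σ ζ : ℝ} {ν : Measure ℝ} {l : ℝ} {W : ℝ → ℝ}

theorem integrable_gaussian_line_mul {a k M : ℝ} (x : ℝ) (hk : 0 < k) {F : ℝ → ℂ}
    (hF : Continuous F) (hM : ∀ u, ‖F u‖ ≤ M) :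
    Integrable fun u : ℝ => Complex.exp (k / 2 * (a + u * Complex.I - x) ^ 2) * F u := by
  refine (((integrable_exp_neg_half_mul_sq hk).const_mul
    (Real.exp (k / 2 * (a - x) ^ 2))).mul_const M).mono'
    (Continuous.aestronglyMeasurable (by fun_prop)) (.of_forall fun u => ?_)
  rw [norm_mul, norm_exp_half_mul_sq]
  simp only [Complex.add_re, Complex.ofReal_re, Complex.mul_re, Complex.I_re, mul_zero,
    Complex.ofReal_im, Complex.I_im, mul_one, sub_self, add_zero, Complex.add_im, Complex.mul_im,
    zero_add]
  rw [mul_sub, sub_eq_add_neg, Real.exp_add, ← neg_mul]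
  gcongr
  exact hM u

/-- The measure `e^{-q y} dy` on `(-∞, 0]`. -/
noncomputable def negExpDensityMeasure (q : ℝ) : Measure ℝ :=
  (volume.restrict (Iic 0)).withDensity fun t => ENNReal.ofReal (Real.exp (-q * t))

instance (q : ℝ) : SFinite (negExpDensityMeasure q) := by
  unfold negExpDensityMeasure
  infer_instance

theorem integrable_exp_mul_negExpDensityMeasure {q s : ℝ} (h : q < s) :
    Integrable (fun t => Real.exp (s * t)) (negExpDensityMeasure q) := by
  unfold negExpDensityMeasure
  rw [integrable_withDensity_iff_integrable_smul' (by fun_prop) (.of_forall fun _ => by simp)]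
  refine (integrableOn_exp_mul_Iic (a := s - q) (by linarith) 0).congr_fun (fun t _ => ?_)
    measurableSet_Iic
  simp only [ENNReal.toReal_ofReal (Real.exp_pos _).le, smul_eq_mul]
  rw [← Real.exp_add]
  ring_nf

theorem integral_cexp_mul_negExpDensityMeasure {q : ℝ} {w : ℂ} (h : q < w.re) :
    ∫ t, Complex.exp (w * t) ∂negExpDensityMeasure q = 1 / (w - q) := by
  unfold negExpDensityMeasure
  rw [integral_withDensity_eq_integral_toReal_smul (by fun_prop) (.of_forall fun _ => by simp)]
  have e (t : ℝ) : (ENNReal.ofReal (Real.exp (-q * t))).toReal • Complex.exp (w * t) =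
      Complex.exp ((w - q) * t) := by
    rw [ENNReal.toReal_ofReal (Real.exp_pos _).le, Complex.real_smul, Complex.ofReal_exp,
      ← Complex.exp_add]
    push_cast
    ring_nf
  simp_rw [e]
  rw [integral_exp_mul_complex_Iic (by simpa using h)]
  simp

theorem withDensity_exp_div_eq {q D : ℝ} (hD : 0 < D) :
    (volume.withDensity fun y => ENNReal.ofReal (Real.exp (-q * y) / D)) =
      ENNReal.ofReal D⁻¹ • (expDensityMeasure q + negExpDensityMeasure q) := by
  have h : expDensityMeasure q + negExpDensityMeasure q =
      volume.withDensity fun t => ENNReal.ofReal (Real.exp (-q * t)) := by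
    unfold expDensityMeasure negExpDensityMeasure
    rw [← restrict_withDensity measurableSet_Ioi, ← restrict_withDensity measurableSet_Iic,
      ← compl_Ioi, Measure.restrict_add_restrict_compl measurableSet_Ioi]
  rw [h, ← withDensity_smul _ (by fun_prop)]
  congr 1
  ext y
  rw [Pi.smul_apply, smul_eq_mul, ← ENNReal.ofReal_mul (by positivity), div_eq_inv_mul]

/-- The potential measure and the reflected scale function add up to an exponential density. On the
lines `Re w = -ζ` and `Re w = l + 1` the Laplace transforms of these measures are the two halves
of the regularized resolvent, and the contour shift between the lines gives the identity of the
Gaussian transforms. -/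
theorem HasLaplaceExponent.potentialMeasure_add_reflectedMeasure
    (hψ : HasLaplaceExponent X P μ σ ν) (hν : IsAdmissibleTriplet σ ζ ν) (hX : IsLevyProcess X P)
    (hl : HasSlopeBound μ σ ζ ν l) (hl0 : 0 < l)
    (hW : IsScaleFunction μ σ ν (realLaplaceExponent μ σ ν l) W) :
    potentialMeasure X P (realLaplaceExponent μ σ ν l) + reflectedMeasure W =
      volume.withDensity fun y => ENNReal.ofReal
        (Real.exp (-l * y) / deriv (realLaplaceExponent μ σ ν) l) := by
  have hζ := hν.zeta_nonneg
  have hlζ : -ζ < l := by linarith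
  have hD1 := hl.one_le_deriv hν hlζ
  have hD := hl.deriv_ne_zero hν hlζ
  rw [withDensity_exp_div_eq (by linarith)]
  set D := deriv (realLaplaceExponent μ σ ν) l with hDdef
  set q := realLaplaceExponent μ σ ν l with hqdef
  have hΦ : rightInverse μ σ ν q = l := hl.rightInverse_eq hζ hl0
  have hq0 : 0 < q := by
    have := hl.add_le (s := 0) (by linarith) hl0
    rw [realLaplaceExponent_zero] at this
    linarith
  have hqζ : realLaplaceExponent μ σ ν (-ζ) < q := by
    have := hl.add_le (s := -ζ) le_rfl hlζ
    linarith
  have := isFiniteMeasure_potentialMeasure (X := X) (P := P) hq0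
  have : SFinite (reflectedMeasure W) := by
    unfold reflectedMeasure
    infer_instance
  have iU := hψ.integrable_exp_potentialMeasure hν hX hqζ
  have iB := hW.integrable_exp_reflectedMeasure (w := l + 1) (by rw [hΦ]; linarith)
  have iE := integrable_exp_mul_expDensityMeasure (q := l) (s := -ζ) hlζ
  have iN := integrable_exp_mul_negExpDensityMeasure (q := l) (s := l + 1) (by linarith)
  have gU (x : ℝ) := integrable_gaussian_of_integrable_exp x one_pos iU
  have gB (x : ℝ) := integrable_gaussian_of_integrable_exp x one_pos iB
  have gE (x : ℝ) := integrable_gaussian_of_integrable_exp x one_pos iE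
  have gN (x : ℝ) := integrable_gaussian_of_integrable_exp x one_pos iN
  have key (x : ℝ) : (∫ y, Real.exp (x * y - y ^ 2 / (2 * 1)) ∂potentialMeasure X P q) +
      ∫ y, Real.exp (x * y - y ^ 2 / (2 * 1)) ∂reflectedMeasure W =
      D⁻¹ * ((∫ y, Real.exp (x * y - y ^ 2 / (2 * 1)) ∂expDensityMeasure l) +
        ∫ y, Real.exp (x * y - y ^ 2 / (2 * 1)) ∂negExpDensityMeasure l) := by
    have tU := integral_gaussian_eq_integral_line x one_pos iU
    have tB := integral_gaussian_eq_integral_line x one_pos iB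
    have tE := integral_gaussian_eq_integral_line x one_pos iE
    have tN := integral_gaussian_eq_integral_line x one_pos iN
    have re1 (u : ℝ) : (((-ζ : ℝ) : ℂ) + u * Complex.I).re = -ζ := by simp
    have re2 (u : ℝ) : (((l + 1 : ℝ) : ℂ) + u * Complex.I).re = l + 1 := by simp
    have c1 : Continuous fun u : ℝ => laplaceExponent μ σ ν (((-ζ : ℝ) : ℂ) + u * Complex.I) :=
      hν.continuousOn_laplaceExponent.comp_continuous (by fun_prop) fun u => (re1 u).ge
    have c2 : Continuous fun u : ℝ => laplaceExponent μ σ ν (((l + 1 : ℝ) : ℂ) + u * Complex.I) :=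
      hν.continuousOn_laplaceExponent.comp_continuous (by fun_prop) fun u =>
        show -ζ ≤ (((l + 1 : ℝ) : ℂ) + u * Complex.I).re by rw [re2]; linarith
    have d1 (u : ℝ) : l + ζ ≤ ‖((-ζ : ℝ) : ℂ) + u * Complex.I - l‖ := by
      have h := Complex.abs_re_le_norm (((-ζ : ℝ) : ℂ) + u * Complex.I - l)
      rw [Complex.sub_re, re1, Complex.ofReal_re] at h
      linarith [(abs_le.1 h).1]
    have d2 (u : ℝ) : 1 ≤ ‖((l + 1 : ℝ) : ℂ) + u * Complex.I - l‖ := by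
      have h := Complex.abs_re_le_norm (((l + 1 : ℝ) : ℂ) + u * Complex.I - l)
      rw [Complex.sub_re, re2, Complex.ofReal_re] at h
      linarith [(abs_le.1 h).2]
    have b1 (u : ℝ) := (d1 u).trans (hl.norm_sub_le_norm_laplaceExponent_sub (re1 u).ge)
    have b2 (u : ℝ) := (d2 u).trans (hl.norm_sub_le_norm_laplaceExponent_sub
      (by rw [re2]; linarith))
    have n1 (u : ℝ) : ((-ζ : ℝ) : ℂ) + u * Complex.I - l ≠ 0 :=
      norm_pos_iff.1 ((by linarith : 0 < l + ζ).trans_le (d1 u))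
    have n2 (u : ℝ) : ((l + 1 : ℝ) : ℂ) + u * Complex.I - l ≠ 0 :=
      norm_pos_iff.1 (one_pos.trans_le (d2 u))
    have m1 (u : ℝ) : laplaceExponent μ σ ν (((-ζ : ℝ) : ℂ) + u * Complex.I) - q ≠ 0 :=
      norm_pos_iff.1 ((by linarith : 0 < l + ζ).trans_le (b1 u))
    have m2 (u : ℝ) : laplaceExponent μ σ ν (((l + 1 : ℝ) : ℂ) + u * Complex.I) - q ≠ 0 :=
      norm_pos_iff.1 (one_pos.trans_le (b2 u))
    simp_rw [fun u : ℝ => hψ.integral_cexp_potentialMeasure hν hX hqζ (re1 u)] at tU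
    simp_rw [fun u : ℝ => hW.integral_cexp_reflectedMeasure hl hν hl0
      (w := ((l + 1 : ℝ) : ℂ) + u * Complex.I) (by rw [re2]; linarith)] at tB
    simp_rw [fun u : ℝ => integral_cexp_mul_expDensityMeasure (q := l)
      (w := ((-ζ : ℝ) : ℂ) + u * Complex.I) (by rw [re1]; exact hlζ)] at tE
    simp_rw [fun u : ℝ => integral_cexp_mul_negExpDensityMeasure (q := l)
      (w := ((l + 1 : ℝ) : ℂ) + u * Complex.I) (by rw [re2]; linarith)] at tN
    obtain ⟨M, hM⟩ := hl.exists_norm_regularizedResolvent_le hν hlζ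
    have hshift := integral_gaussian_mul_eq_of_strip x (by linarith : -ζ ≤ l + 1) one_pos
      ((hl.continuousOn_regularizedResolvent hν hlζ).mono fun w hw => hw.1)
      ((hl.differentiableOn_regularizedResolvent hν hlζ).mono fun w hw => hw.1)
      (fun w hw _ => hM w hw)
    have jU := integrable_gaussian_line_mul (a := -ζ) (M := 1 / (l + ζ)) x one_pos
      (F := fun u => 1 / (q - laplaceExponent μ σ ν (((-ζ : ℝ) : ℂ) + u * Complex.I)))
      (continuous_const.div (by fun_prop) fun u => by
        rw [← neg_sub]; exact neg_ne_zero.2 (m1 u)) (fun u => by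
        rw [norm_div, norm_one, norm_sub_rev]
        exact one_div_le_one_div_of_le (by linarith) (b1 u))
    have jB := integrable_gaussian_line_mul (a := l + 1) (M := 1 / 1) x one_pos
      (F := fun u => 1 / (laplaceExponent μ σ ν (((l + 1 : ℝ) : ℂ) + u * Complex.I) - q))
      (continuous_const.div (by fun_prop) m2) (fun u => by
        rw [norm_div, norm_one]
        exact one_div_le_one_div_of_le one_pos (b2 u))
    have jE := integrable_gaussian_line_mul (a := -ζ) (M := 1 / (l + ζ)) x one_pos
      (F := fun u => 1 / (l - (((-ζ : ℝ) : ℂ) + u * Complex.I)))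
      (continuous_const.div (by fun_prop) fun u => by
        rw [← neg_sub]; exact neg_ne_zero.2 (n1 u)) (fun u => by
        rw [norm_div, norm_one, norm_sub_rev]
        exact one_div_le_one_div_of_le (by linarith) (d1 u))
    have jN := integrable_gaussian_line_mul (a := l + 1) (M := 1 / 1) x one_pos
      (F := fun u => 1 / (((l + 1 : ℝ) : ℂ) + u * Complex.I - l))
      (continuous_const.div (by fun_prop) n2) (fun u => by
        rw [norm_div, norm_one]
        exact one_div_le_one_div_of_le one_pos (d2 u))
    -- the boundary values of the regularized resolvent on the two lines are differences of the
    -- Laplace transforms of the measures involved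
    have e1 (u : ℝ) : regularizedResolvent μ σ ν l (((-ζ : ℝ) : ℂ) + u * Complex.I) =
        (D : ℂ)⁻¹ * (1 / (l - (((-ζ : ℝ) : ℂ) + u * Complex.I))) -
          1 / (q - laplaceExponent μ σ ν (((-ζ : ℝ) : ℂ) + u * Complex.I)) := by
      rw [hl.regularizedResolvent_eq hν hlζ (re1 u).ge (sub_ne_zero.1 (n1 u)), ← hDdef, ← hqdef,
        ← neg_sub _ (q : ℂ), ← neg_sub _ (l : ℂ), div_neg, div_neg]
      simp only [one_div, mul_inv]
      ring
    have e2 (u : ℝ) : regularizedResolvent μ σ ν l (((l + 1 : ℝ) : ℂ) + u * Complex.I) =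
        1 / (laplaceExponent μ σ ν (((l + 1 : ℝ) : ℂ) + u * Complex.I) - q) -
          (D : ℂ)⁻¹ * (1 / (((l + 1 : ℝ) : ℂ) + u * Complex.I - l)) := by
      rw [hl.regularizedResolvent_eq hν hlζ (by rw [re2]; linarith) (sub_ne_zero.1 (n2 u)),
        ← hDdef, ← hqdef]
      simp only [one_div, mul_inv]
    simp_rw [e1, e2, mul_sub, mul_left_comm _ ((D : ℂ)⁻¹)] at hshift
    rw [integral_sub (jE.const_mul _) jU, integral_sub jB (jN.const_mul _), integral_const_mul,
      integral_const_mul, ← tU, ← tB, ← tE, ← tN] at hshift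
    have hs : ((√(2 * Real.pi / 1) : ℝ) : ℂ) ≠ 0 := by
      exact_mod_cast (Real.sqrt_pos.2 (by positivity)).ne'
    refine Complex.ofReal_injective (mul_left_cancel₀ hs ?_)
    simp only [Complex.ofReal_add, Complex.ofReal_mul, Complex.ofReal_inv]
    linear_combination -hshift
  have hsmul : ENNReal.ofReal D⁻¹ ≠ ∞ := ENNReal.ofReal_ne_top
  simp only [mul_one] at gU gB gE gN key
  refine ext_of_gaussian_transform (fun x => (gU x).add_measure (gB x))
    (fun x => ((gE x).add_measure (gN x)).smul_measure hsmul) fun x => ?_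
  rw [integral_add_measure (gU x) (gB x), integral_smul_measure,
    integral_add_measure (gE x) (gN x), key, ENNReal.toReal_ofReal (by positivity), smul_eq_mul]

/-- The potential measure has the density `e^{-l y} / ψ'(l) - W(-y)`, which is nonnegative almost
everywhere. -/
theorem HasLaplaceExponent.potentialMeasure_eq_withDensity
    (hψ : HasLaplaceExponent X P μ σ ν) (hν : IsAdmissibleTriplet σ ζ ν) (hX : IsLevyProcess X P)
    (hl : HasSlopeBound μ σ ζ ν l) (hl0 : 0 < l)
    (hW : IsScaleFunction μ σ ν (realLaplaceExponent μ σ ν l) W) :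
    potentialMeasure X P (realLaplaceExponent μ σ ν l) = volume.withDensity (fun y =>
      ENNReal.ofReal (Real.exp (-l * y) / deriv (realLaplaceExponent μ σ ν) l - W (-y))) ∧
    ∀ᵐ y, W (-y) ≤ Real.exp (-l * y) / deriv (realLaplaceExponent μ σ ν) l := by
  have hsum := hψ.potentialMeasure_add_reflectedMeasure hν hX hl hl0 hW
  set D := deriv (realLaplaceExponent μ σ ν) l
  set q := realLaplaceExponent μ σ ν l with hq
  have hD : 0 < D := one_pos.trans_le
    (hl.one_le_deriv hν (by linarith [hν.zeta_nonneg]))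
  have hq0 : 0 < q := by
    have := hl.add_le (s := 0) (by linarith [hν.zeta_nonneg]) hl0
    rw [realLaplaceExponent_zero] at this
    linarith
  have := isFiniteMeasure_potentialMeasure (X := X) (P := P) hq0
  have hac : potentialMeasure X P q ≪ volume := by
    refine (Measure.absolutelyContinuous_of_le
      (ν := potentialMeasure X P q + reflectedMeasure W) (Measure.le_add_right le_rfl)).trans ?_
    rw [hsum]
    exact withDensity_absolutelyContinuous _ _
  have hu := Measure.withDensity_rnDeriv_eq _ _ hac
  set u := (potentialMeasure X P q).rnDeriv volume
  have hum : Measurable u := Measure.measurable_rnDeriv _ _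
  rw [← hu, reflectedMeasure, ← withDensity_add_left hum,
    withDensity_eq_iff_of_sigmaFinite (hum.aemeasurable.add
      hW.aemeasurable_neg.ennreal_ofReal) (by fun_prop)] at hsum
  have hle : ∀ᵐ y, W (-y) ≤ Real.exp (-l * y) / D := by
    filter_upwards [hsum] with y hy
    have h1 : ENNReal.ofReal (W (-y)) ≤ ENNReal.ofReal (Real.exp (-l * y) / D) := by
      rw [← hy]
      exact le_add_self
    exact (ENNReal.ofReal_le_ofReal_iff (by positivity)).1 h1
  refine ⟨?_, hle⟩
  rw [← hu]
  refine withDensity_congr_ae ?_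
  filter_upwards [hsum] with y hy
  rw [ENNReal.ofReal_sub _ (hW.nonneg _), ← hy, Pi.add_apply,
    ENNReal.add_sub_cancel_right ENNReal.ofReal_ne_top]

end Decomposition

/-! ### The two representations of the extension -/

section Representation

variable {Ω : Type*} [MeasurableSpace Ω] {P : Measure Ω} [IsProbabilityMeasure P]
  {X : ℝ≥0 → Ω → ℝ} {μ σ ζ : ℝ} {ν : Measure ℝ} {l : ℝ} {W h : ℝ → ℝ} {hhat : ℝ → ℂ}

/-- The extension at a large real point `l` is `ψ'(l)` times the integral of the payoff against the
`ψ(l)`-potential measure. -/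
theorem HasSlopeBound.integral_extensionKernel_mul (hl : HasSlopeBound μ σ ζ ν l)
    (hψ : HasLaplaceExponent X P μ σ ν) (hν : IsAdmissibleTriplet σ ζ ν) (hX : IsLevyProcess X P)
    (hl0 : 0 < l) (hh : IsAdmissiblePayoff ζ h hhat) :
    ((deriv (realLaplaceExponent μ σ ν) l *
      ∫ y, h y ∂potentialMeasure X P (realLaplaceExponent μ σ ν l) : ℝ) : ℂ) =
        ∫ z : ℝ, extensionKernel μ σ ζ ν (l : ℂ) z * hhat z := by
  have hζ := hν.zeta_nonneg
  have hlζ : -ζ < l := by linarith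
  have hq0 : 0 < realLaplaceExponent μ σ ν l := by
    have := hl.add_le (s := 0) (by linarith) hl0
    rw [realLaplaceExponent_zero] at this
    linarith
  have hqζ : realLaplaceExponent μ σ ν (-ζ) < realLaplaceExponent μ σ ν l := by
    have := hl.add_le (s := -ζ) le_rfl hlζ
    linarith
  have := isFiniteMeasure_potentialMeasure (X := X) (P := P) hq0
  have hU := hh.integral_eq (hψ.integrable_exp_potentialMeasure hν hX hqζ)
  simp_rw [fun z => hψ.integral_cexp_potentialMeasure hν hX hqζ (re_neg_sub_I_mul ζ z)] at hU
  have hd (z : ℝ) : l + ζ ≤ ‖(l : ℂ) + ζ + Complex.I * z‖ := by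
    have h := Complex.re_le_norm ((l : ℂ) + ζ + Complex.I * z)
    simpa using h
  have hd' (z : ℝ) : l + ζ ≤ ‖(realLaplaceExponent μ σ ν l : ℂ) -
      laplaceExponent μ σ ν (-ζ - Complex.I * z)‖ := by
    have h := hl.norm_sub_le_norm_laplaceExponent_sub (re_neg_sub_I_mul ζ z).ge
    have e : (-ζ - Complex.I * z - l : ℂ) = -(l + ζ + Complex.I * z) := by ring
    rw [e, norm_neg, norm_sub_rev] at h
    exact (hd z).trans h
  have hpos : 0 < l + ζ := by linarith
  have i1 : Integrable fun z : ℝ => 1 / ((realLaplaceExponent μ σ ν l : ℂ) -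
      laplaceExponent μ σ ν (-ζ - Complex.I * z)) * hhat z := by
    refine hh.integrable.bdd_mul (c := 1 / (l + ζ)) (Continuous.aestronglyMeasurable ?_)
      (.of_forall fun z => ?_)
    · exact continuous_const.div (continuous_const.sub hν.continuous_laplaceExponent_line)
        fun z => norm_pos_iff.1 (hpos.trans_le (hd' z))
    · rw [norm_div, norm_one]
      exact one_div_le_one_div_of_le hpos (hd' z)
  have i2 : Integrable fun z : ℝ => 1 / ((l : ℂ) + ζ + Complex.I * z) * hhat z := by
    refine hh.integrable.bdd_mul (c := 1 / (l + ζ)) (Continuous.aestronglyMeasurable ?_)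
      (.of_forall fun z => ?_)
    · exact continuous_const.div (by fun_prop) fun z => norm_pos_iff.1 (hpos.trans_le (hd z))
    · rw [norm_div, norm_one]
      exact one_div_le_one_div_of_le hpos (hd z)
  have e (z : ℝ) : extensionKernel μ σ ζ ν (l : ℂ) z * hhat z =
      ((deriv (realLaplaceExponent μ σ ν) l : ℝ) : ℂ) * (1 / ((realLaplaceExponent μ σ ν l : ℂ) -
        laplaceExponent μ σ ν (-ζ - Complex.I * z)) * hhat z) -
      1 / ((l : ℂ) + ζ + Complex.I * z) * hhat z := by
    rw [extensionKernel, hν.deriv_laplaceExponent_ofReal hlζ, laplaceExponent_ofReal]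
    ring
  simp_rw [e]
  rw [integral_sub (i1.const_mul _) i2, hh.integral_inv_eq_zero hlζ, sub_zero,
    integral_const_mul, ← hU, Complex.ofReal_mul]

/-- The integral of the payoff against the potential measure in terms of the scale function. -/
theorem HasSlopeBound.integral_scaleFunction (hl : HasSlopeBound μ σ ζ ν l)
    (hψ : HasLaplaceExponent X P μ σ ν) (hν : IsAdmissibleTriplet σ ζ ν) (hX : IsLevyProcess X P)
    (hl0 : 0 < l) (hh : IsAdmissiblePayoff ζ h hhat)
    (hint : Integrable h (potentialMeasure X P (realLaplaceExponent μ σ ν l)))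
    (hW : IsScaleFunction μ σ ν (realLaplaceExponent μ σ ν l) W) :
    IntegrableOn (fun x : ℝ =>
      (Real.exp (l * x) - deriv (realLaplaceExponent μ σ ν) l * W x) * h (-x)) (Ioi 0) ∧
    deriv (realLaplaceExponent μ σ ν) l *
        ∫ y, h y ∂potentialMeasure X P (realLaplaceExponent μ σ ν l) =
      ∫ x in Ioi (0 : ℝ),
        (Real.exp (l * x) - deriv (realLaplaceExponent μ σ ν) l * W x) * h (-x) := by
  obtain ⟨hU, hle⟩ := hψ.potentialMeasure_eq_withDensity hν hX hl hl0 hW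
  have hD := hl.one_le_deriv hν (by linarith [hν.zeta_nonneg])
  set D := deriv (realLaplaceExponent μ σ ν) l
  have hm : AEMeasurable fun y => ENNReal.ofReal (Real.exp (-l * y) / D - W (-y)) :=
    (AEMeasurable.sub (by fun_prop) hW.aemeasurable_neg).ennreal_ofReal
  have hae : (fun y => (ENNReal.ofReal (Real.exp (-l * y) / D - W (-y))).toReal • h y) =ᵐ[volume]
      fun y => (Real.exp (-l * y) / D - W (-y)) * h y := by
    filter_upwards [hle] with y hy
    rw [ENNReal.toReal_ofReal (by linarith), smul_eq_mul]
  have e (x : ℝ) : D * ((Real.exp (-l * -x) / D - W (- -x)) * h (-x)) =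
      (Real.exp (l * x) - D * W x) * h (-x) := by
    rw [neg_neg, neg_mul_neg]
    field_simp
  rw [hU] at hint ⊢
  rw [integrable_withDensity_iff_integrable_smul₀' hm (.of_forall fun _ => by simp),
    integrable_congr hae] at hint
  rw [integral_withDensity_eq_integral_toReal_smul₀ hm (.of_forall fun _ => by simp),
    integral_congr_ae hae]
  refine ⟨?_, ?_⟩
  · have h1 := hint.comp_neg.const_mul D
    simp_rw [e] at h1
    exact h1.integrableOn
  · rw [← integral_const_mul, ← integral_neg_eq_self]
    simp_rw [e]
    -- the payoff restricts the reflected integral to the positive half-line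
    refine (setIntegral_eq_integral_of_forall_compl_eq_zero fun x hx => ?_).symm
    have : h (-x) = 0 := by
      by_contra hne
      have := hh.support_subset hne
      exact hx (by simpa using this)
    rw [this, mul_zero]

end Representation

theorem mainTheorem3 {Ω : Type*} [MeasurableSpace Ω] (P : Measure Ω) [IsProbabilityMeasure P]
    (X : ℝ≥0 → Ω → ℝ) (μ σ ζ : ℝ) (ν : Measure ℝ) (hν : IsAdmissibleTriplet σ ζ ν)
    (hX : IsLevyProcess X P) (hψ : HasLaplaceExponent X P μ σ ν) :
    (∃ c R₁ : ℝ, IsAprioriBound μ σ ζ ν c R₁) ∧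
    ∀ c R₁ : ℝ, IsAprioriBound μ σ ζ ν c R₁ →
      ∀ (h : ℝ → ℝ) (hhat : ℝ → ℂ), IsAdmissiblePayoff ζ h hhat →
        (∀ w : ℂ, R₁ < w.re → Integrable (fun z : ℝ => extensionKernel μ σ ζ ν w z * hhat z)) ∧
        AnalyticOnNhd ℂ (fun w : ℂ => ∫ z : ℝ, extensionKernel μ σ ζ ν w z * hhat z)
          {w : ℂ | R₁ < w.re} ∧
        ∀ᶠ l : ℝ in atTop,
          Integrable (fun p : Ω × ℝ =>
              Real.exp (-realLaplaceExponent μ σ ν l * p.2) * h (X p.2.toNNReal p.1))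
            (P.prod (volume.restrict (Ioi 0))) ∧
          ((deriv (realLaplaceExponent μ σ ν) l *
              timeLaplace X P h (realLaplaceExponent μ σ ν l) : ℝ) : ℂ) =
            ∫ z : ℝ, extensionKernel μ σ ζ ν (l : ℂ) z * hhat z ∧
          ∀ W : ℝ → ℝ, IsScaleFunction μ σ ν (realLaplaceExponent μ σ ν l) W →
            IntegrableOn (fun x : ℝ =>
              (Real.exp (l * x) - deriv (realLaplaceExponent μ σ ν) l * W x) * h (-x)) (Ioi 0) ∧
            deriv (realLaplaceExponent μ σ ν) l *
                timeLaplace X P h (realLaplaceExponent μ σ ν l) =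
              ∫ x in Ioi (0 : ℝ),
                (Real.exp (l * x) - deriv (realLaplaceExponent μ σ ν) l * W x) * h (-x) := by
  refine ⟨hν.exists_isAprioriBound μ, fun c R₁ hB h hhat hh => ⟨fun w hw =>
    hB.integrable_extensionKernel_mul hν hh.integrable hw.le,
    hB.analyticOnNhd_integral_extensionKernel hν hh.integrable, ?_⟩⟩
  filter_upwards [hν.eventually_hasSlopeBound μ] with l ⟨hl0, hl⟩
  have hqζ : realLaplaceExponent μ σ ν (-ζ) < realLaplaceExponent μ σ ν l := by
    have h0 := hν.zeta_nonneg
    have := hl.add_le (s := -ζ) le_rfl (by linarith)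
    linarith
  have hint : Integrable h (potentialMeasure X P (realLaplaceExponent μ σ ν l)) :=
    hh.integrable_of_integrable_exp (hψ.integrable_exp_potentialMeasure hν hX hqζ)
  have hhm := hh.continuous.measurable
  rw [← hX.integral_potentialMeasure hhm hint]
  exact ⟨(hX.integrable_potentialMeasure_iff hhm).1 hint,
    hl.integral_extensionKernel_mul hψ hν hX hl0 hh,
    fun W hW => hl.integral_scaleFunction hψ hν hX hl0 hh hint hW⟩
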